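/- Let $m\ge 2$ be an integer and let $\{0,1,\dots,m-1\}^{\mathbb N}$ be the set of sequences $\omega=\omega_1\omega_2\cdots$ with the metric $d(u,\omega)=m^{-\min\{i\ge1:\,u_i\neq\omega_i\}}$ for $u\ne\omega$, $d(\omega,\omega)=0$, and the shift $(\sigma\omega)_i=\omega_{i+1}$. Let $\Sigma\subset\{0,\dots,m-1\}^{\mathbb N}$ be a subshift, i.e. a closed set with $\sigma(\Sigma)\subset\Sigma$. Let $\Sigma^n$ be the set of words of length $n$ that are prefixes of elements of $\Sigma$, and let $\Sigma^*=\bigcup_{n\ge1}\Sigma^n$. Assume that * $\Sigma$ has specification: there is $M\in\mathbb N$ such that for all $u,v\in\Sigma^*$ there is $w\in\Sigma^M$ with $uwv\in\Sigma^*$; * the topological entropy $h(\Sigma)=\lim_{n\to\infty}\frac1n\log\#\Sigma^n=\inf_{n\ge1}\frac1n\log\#\Sigma^n$ is positive; * $0^\infty=000\cdots\in\Sigma$. Let $\psi:(0,\infty)\to(0,\infty)$ satisfy $\psi(x)\to0$ as $x\to\infty$, and let $$H_{ea}(\sigma,\psi)=\{\omega\in\Sigma:\ \text{for all sufficiently large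 } N \text{ there is } 1\le n\le N \text{ with } d(\sigma^n\omega,0^\infty)<\psi(N)\}.$$ Suppose that the limit $\tau=\lim_{N\to\infty}\frac{-\log_m\psi(N)}{N}$ exists in $(-\infty,+\infty]$ ($\tau=+\infty$ is allowed). (i) If $\tau>1$, then $H_{ea}(\sigma,\psi)=\bigcup_{n=0}^{\infty}\{\omega\in\Sigma:\sigma^n\omega=0^\infty\}$. (ii) If $0\le\tau\le1$, then $\dim_{\mathrm H}H_{ea}(\sigma,\psi)=\left(\frac{1-\tau}{1+\tau}\right)^2\dim_{\mathrm H}\Sigma$, where $\dim_{\mathrm H}$ is the Hausdorff dimension with respect to $d$. -/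

import Mathlib

open Filter Topology

namespace SymbolicShift

/-- The distance on `{0, …, m-1}^ℕ`. Sequences are indexed from `0` here, so the letter `ω_i`
(`i ≥ 1`) of the usual notation is `ω (i - 1)`, and `min {i ≥ 1 : u_i ≠ ω_i}` is
`PiNat.firstDiff u ω + 1`. -/
noncomputable def wordDist {m : ℕ} (u w : ℕ → Fin m) : ℝ :=
  open scoped Classical in
  if u = w then 0 else ((m : ℝ) ^ (PiNat.firstDiff u w + 1))⁻¹

theorem wordDist_self {m : ℕ} (u : ℕ → Fin m) : wordDist u u = 0 := by
  simp [wordDist]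

theorem wordDist_of_ne {m : ℕ} {u w : ℕ → Fin m} (h : u ≠ w) :
    wordDist u w = ((m : ℝ) ^ (PiNat.firstDiff u w + 1))⁻¹ := by
  simp [wordDist, h]

theorem wordDist_comm {m : ℕ} (u w : ℕ → Fin m) : wordDist u w = wordDist w u := by
  rcases eq_or_ne u w with rfl | h
  · rfl
  · rw [wordDist_of_ne h, wordDist_of_ne h.symm, PiNat.firstDiff_comm]

section Metric

variable {m : ℕ} [hm : m.AtLeastTwo]

theorem one_lt_card : (1 : ℝ) < m := by
  exact_mod_cast hm.prop

theorem card_pos : (0 : ℝ) < m := zero_lt_one.trans one_lt_card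

theorem wordDist_nonneg (u w : ℕ → Fin m) : 0 ≤ wordDist u w := by
  rcases eq_or_ne u w with rfl | h
  · rw [wordDist_self]
  · rw [wordDist_of_ne h]; positivity

theorem eq_of_wordDist_eq_zero (u w : ℕ → Fin m) (h : wordDist u w = 0) : u = w := by
  by_contra hne
  rw [wordDist_of_ne hne] at h
  have := card_pos (m := m)
  have h2 : (0 : ℝ) < ((m : ℝ) ^ (PiNat.firstDiff u w + 1))⁻¹ := by positivity
  exact h2.ne' h

theorem wordDist_triangle (x y z : ℕ → Fin m) :
    wordDist x z ≤ wordDist x y + wordDist y z := by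
  rcases eq_or_ne x z with rfl | hxz
  · rw [wordDist_self]
    exact add_nonneg (wordDist_nonneg _ _) (wordDist_nonneg _ _)
  rcases eq_or_ne x y with rfl | hxy
  · rw [wordDist_self, zero_add]
  rcases eq_or_ne y z with rfl | hyz
  · rw [wordDist_self, add_zero]
  have key : ∀ {a b : ℕ}, a ≤ b → ((m : ℝ) ^ (b + 1))⁻¹ ≤ ((m : ℝ) ^ (a + 1))⁻¹ := by
    intro a b hab
    have h0 := card_pos (m := m)
    exact inv_anti₀ (by positivity)
      (pow_le_pow_right₀ (one_lt_card (m := m)).le (Nat.succ_le_succ hab))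
  rcases min_le_iff.1 (PiNat.min_firstDiff_le x y z hxz) with h | h
  · refine le_trans ?_ (le_add_of_nonneg_right (wordDist_nonneg _ _))
    rw [wordDist_of_ne hxz, wordDist_of_ne hxy]
    exact key h
  · refine le_trans ?_ (le_add_of_nonneg_left (wordDist_nonneg _ _))
    rw [wordDist_of_ne hxz, wordDist_of_ne hyz]
    exact key h

theorem wordDist_lt_iff (x y : ℕ → Fin m) (n : ℕ) :
    wordDist x y < ((m : ℝ) ^ n)⁻¹ ↔ ∀ i < n, x i = y i := by
  have h0 := card_pos (m := m)
  rcases eq_or_ne x y with rfl | h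
  · rw [wordDist_self]
    simp only [implies_true, iff_true]
    positivity
  · rw [wordDist_of_ne h, inv_lt_inv₀ (by positivity) (by positivity),
      pow_lt_pow_iff_right₀ one_lt_card, Nat.lt_succ_iff]
    refine ⟨fun hn i hi => PiNat.apply_eq_of_lt_firstDiff (hi.trans_le hn), fun hn => ?_⟩
    by_contra hlt
    exact PiNat.apply_firstDiff_ne h (hn _ (not_le.1 hlt))

theorem isOpen_iff_wordDist (s : Set (ℕ → Fin m)) :
    IsOpen s ↔ ∀ x ∈ s, ∃ ε > 0, ∀ y, wordDist x y < ε → y ∈ s := by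
  have h0 := card_pos (m := m)
  constructor
  · intro hs x hx
    obtain ⟨v, ⟨y, n, rfl⟩, h'x, h's⟩ :=
      (PiNat.isTopologicalBasis_cylinders fun _ => Fin m).exists_subset_of_mem_open hx hs
    rw [← PiNat.mem_cylinder_iff_eq.1 h'x] at h's
    refine ⟨((m : ℝ) ^ n)⁻¹, by positivity, fun z hz => h's ?_⟩
    exact fun i hi => (((wordDist_lt_iff x z n).1 hz) i hi).symm
  · intro h
    refine (PiNat.isTopologicalBasis_cylinders fun _ => Fin m).isOpen_iff.2 fun x hx => ?_
    obtain ⟨ε, εpos, hε⟩ := h x hx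
    obtain ⟨n, hn⟩ := exists_pow_lt_of_lt_one εpos (inv_lt_one_of_one_lt₀ (one_lt_card (m := m)))
    refine ⟨PiNat.cylinder x n, ⟨x, n, rfl⟩, PiNat.self_mem_cylinder x n, fun y hy => hε y ?_⟩
    rw [inv_pow] at hn
    exact ((wordDist_lt_iff x y n).2 fun i hi => (hy i hi).symm).trans hn

/-- The symbolic space `{0, …, m-1}^ℕ`, `m ≥ 2`, with the metric
`d(u, ω) = m ^ (- min {i ≥ 1 : u_i ≠ ω_i})`. Its topology is (definitionally) the product
topology. -/
noncomputable instance symbolicMetric : MetricSpace (ℕ → Fin m) :=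
  MetricSpace.ofDistTopology wordDist wordDist_self wordDist_comm wordDist_triangle
    isOpen_iff_wordDist eq_of_wordDist_eq_zero

end Metric

/-- The words of length `n` that are prefixes of elements of `S`. -/
def words {m : ℕ} (S : Set (ℕ → Fin m)) (n : ℕ) : Set (List (Fin m)) :=
  {w | ∃ u ∈ S, w = List.ofFn fun i : Fin n => u i}

/-- All (nonempty) finite words of `S`. -/
def language {m : ℕ} (S : Set (ℕ → Fin m)) : Set (List (Fin m)) :=
  ⋃ n ≥ 1, words S n

/-- The specification property: with one gap length `M`, any two words of `S` can be joined, in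
the given order, by a word of `S` of length exactly `M`. -/
def HasSpecification {m : ℕ} (S : Set (ℕ → Fin m)) : Prop :=
  ∃ M : ℕ, ∀ u ∈ language S, ∀ v ∈ language S, ∃ w ∈ words S M, u ++ w ++ v ∈ language S

/-- The topological entropy `inf_{n ≥ 1} (log #Σⁿ) / n` of a subshift; it is also the limit of
`(log #Σⁿ) / n`, see `tendsto_entropy`. -/
noncomputable def entropy {m : ℕ} (S : Set (ℕ → Fin m)) : ℝ :=
  sInf ((fun n : ℕ => Real.log ((words S n).ncard) / n) '' Set.Ici 1)

theorem finite_words {m : ℕ} (S : Set (ℕ → Fin m)) (n : ℕ) : (words S n).Finite := by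
  refine (Set.finite_range fun f : Fin n → Fin m => List.ofFn f).subset ?_
  rintro _ ⟨u, -, rfl⟩
  exact ⟨fun i : Fin n => u i, rfl⟩

theorem ncard_words_add_le {m : ℕ} (S : SymbolicDynamics.FullShift.Subshift (Fin m) ℕ)
    (i j : ℕ) :
    (words S.carrier (i + j)).ncard ≤
      (words S.carrier i).ncard * (words S.carrier j).ncard := by
  have hfin := (finite_words S.carrier i).prod (finite_words S.carrier j)
  rw [← Set.ncard_prod]
  refine le_trans (Set.ncard_le_ncard ?_ (hfin.image fun p => p.1 ++ p.2))
    (Set.ncard_image_le hfin)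
  rintro _ ⟨u, hu, rfl⟩
  refine ⟨(List.ofFn fun k : Fin i => u k, List.ofFn fun k : Fin j => u (i + k)),
    ⟨⟨u, hu, rfl⟩, ⟨_, S.mapsTo i hu, rfl⟩⟩, ?_⟩
  exact (List.ofFn_fin_append _ _).symm.trans (congrArg List.ofFn (by
    funext k
    refine Fin.addCases (fun a => ?_) (fun a => ?_) k <;> simp))

theorem tendsto_entropy {m : ℕ} (S : SymbolicDynamics.FullShift.Subshift (Fin m) ℕ) :
    Tendsto (fun n : ℕ => Real.log ((words S.carrier n).ncard) / n) atTop
      (𝓝 (entropy S.carrier)) := by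
  have hsub : Subadditive fun n : ℕ => Real.log ((words S.carrier n).ncard) := by
    intro i j
    rcases Set.eq_empty_or_nonempty S.carrier with h | ⟨u, hu⟩
    · simp [words, h]
    have hpos : ∀ n, 0 < (words S.carrier n).ncard := fun n =>
      (Set.ncard_pos (finite_words _ n)).2 ⟨_, u, hu, rfl⟩
    have hi := hpos i
    have hj := hpos j
    rw [← Real.log_mul (by positivity) (by positivity)]
    exact Real.log_le_log (by exact_mod_cast hpos _) (by exact_mod_cast ncard_words_add_le S i j)
  have hbdd : BddBelow
      (Set.range fun n : ℕ => Real.log ((words S.carrier n).ncard) / n) := by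
    refine ⟨0, ?_⟩
    rintro _ ⟨n, rfl⟩
    exact div_nonneg (Real.log_natCast_nonneg _) (Nat.cast_nonneg _)
  have h := hsub.tendsto_lim hbdd
  rwa [Subadditive.lim] at h

/-- The points of `S` that are eventually always hitting for the map `T` and the targets `E N`:
for all large `N` there is `1 ≤ n ≤ N` with `Tⁿ x ∈ E N`. -/
def eventuallyAlwaysHitting {X : Type*} (S : Set X) (T : X → X) (E : ℕ → Set X) : Set X :=
  {x ∈ S | ∀ᶠ N in atTop, ∃ n, 1 ≤ n ∧ n ≤ N ∧ T^[n] x ∈ E N}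

/-- The left shift `(σ u)_i = u_{i+1}`. -/
def leftShift {m : ℕ} : (ℕ → Fin m) → (ℕ → Fin m) := fun u i => u (i + 1)

/-- The sequence `0^∞`. -/
def zeroSeq {m : ℕ} [NeZero m] : ℕ → Fin m := fun _ => 0

/-- `H_ea(σ, ψ)`: the targets are the balls of `S` with centre `0^∞` and radius `ψ N`. -/
def Hea {m : ℕ} [m.AtLeastTwo] (S : Set (ℕ → Fin m)) (ψ : ℝ → ℝ) : Set (ℕ → Fin m) :=
  eventuallyAlwaysHitting S leftShift fun N => {w ∈ S | dist w zeroSeq < ψ N}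

end SymbolicShift

/-! A point of `Hea` has, for every large N, a zero run of length about τN starting in [1, N]. If τ
> 1 this run covers position N + 1, so all late letters vanish. If τ ≤ 1, the dimension counts the
letters left free by the zero runs, each free letter being worth the entropy h.

Upper bound. If u is not eventually zero, its successive record runs [n_k, n_k + x_k) are disjoint
and satisfy τ n_{k+1} ≤ x_k (`exists_record_zero_runs`). For each D > ((1-τ)/(1+τ))², D < 1, a
discriminant argument (`exists_sub_sum_le`) shows that infinitely often at most a proportion D of
the prefix of length n_k + x_k lies outside the runs. Such prefixes are lists of blocks "free word,
then a long zero run". Their weights are multiplicative, so the sum over all lists is a geometric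
series (`tsum_list_prod`), which converges once the zero runs are required to be long enough. A
Hausdorff–Cantelli cover concludes (`dimH_uniformZeroRuns_le`).

Lower bound. Specification allows arbitrary free words between prescribed zero blocks, with gaps of
constant length (`exists_coding`). The product of uniform measures on the free words is pushed
forward to the subshift (`exists_coded_measure`). With free words of length n_k and zero blocks of
length about v n_k, v = 2τ/(1-τ), the mass distribution principle gives the matching exponent
(`le_dimH_uniformZeroRunsFrom`). The same bound as τ → 0 yields dim Σ = h / log m. -/

namespace SymbolicShift

open MeasureTheory Set ProbabilityTheory

/-! ### Hausdorff dimension through cylinders -/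

section HausdorffDimension

variable {m : ℕ} [m.AtLeastTwo]

theorem log_card_pos : 0 < Real.log m := Real.log_pos one_lt_card

theorem inv_card_pow_eq_exp (n : ℕ) : ((m : ℝ) ^ n)⁻¹ = Real.exp (-(Real.log m * n)) := by
  rw [Real.exp_neg, mul_comm, Real.exp_nat_mul, Real.exp_log card_pos]

theorem edist_lt_iff (x y : ℕ → Fin m) (n : ℕ) :
    edist x y < ENNReal.ofReal (Real.exp (-(Real.log m * n))) ↔ ∀ i < n, x i = y i := by
  rw [edist_dist, ENNReal.ofReal_lt_ofReal_iff (Real.exp_pos _), ← inv_card_pow_eq_exp]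
  exact wordDist_lt_iff x y n

theorem ediam_le_of_agree {t : Set (ℕ → Fin m)} {n : ℕ}
    (h : ∀ x ∈ t, ∀ y ∈ t, ∀ i < n, x i = y i) :
    Metric.ediam t ≤ ENNReal.ofReal (Real.exp (-(Real.log m * n))) :=
  Metric.ediam_le fun x hx y hy => ((edist_lt_iff x y n).2 (h x hx y hy)).le

theorem ofReal_exp_rpow (c : ℝ) (n : ℕ) :
    ENNReal.ofReal (Real.exp (-(Real.log m * n))) ^ (c / Real.log m) =
      ENNReal.ofReal (Real.exp (-(c * n))) := by
  have := log_card_pos (m := m)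
  rw [ENNReal.ofReal_rpow_of_pos (Real.exp_pos _), ← Real.exp_mul]
  congr 2
  field_simp

theorem tendsto_ofReal_exp_neg {c : ℝ} (hc : 0 < c) :
    Tendsto (fun n : ℕ => ENNReal.ofReal (Real.exp (-(c * n)))) atTop (𝓝 0) := by
  rw [← ENNReal.ofReal_zero]
  refine ENNReal.tendsto_ofReal (Real.tendsto_exp_neg_atTop_nhds_zero.comp ?_)
  exact tendsto_natCast_atTop_atTop.const_mul_atTop hc

/-- A Hausdorff–Cantelli bound: if the points of `A` lie in arbitrarily long cylinders of a family
whose `c`-weights are summable, then `dim A ≤ c / log m`. -/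
theorem dimH_le_of_tsum_ne_top {ι : Type*} [Countable ι] {A : Set (ℕ → Fin m)}
    (t : ι → Set (ℕ → Fin m)) (L : ι → ℕ) {c : ℝ} (hc : 0 ≤ c)
    (hagree : ∀ i, ∀ x ∈ t i, ∀ y ∈ t i, ∀ j < L i, x j = y j)
    (hcover : ∀ w ∈ A, ∀ K, ∃ i, K ≤ L i ∧ w ∈ t i)
    (hsum : ∑' i, ENNReal.ofReal (Real.exp (-(c * L i))) ≠ ⊤) :
    dimH A ≤ ENNReal.ofReal (c / Real.log m) := by
  have hlog := log_card_pos (m := m)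
  have hd : 0 ≤ c / Real.log m := by positivity
  refine dimH_le_of_hausdorffMeasure_ne_top (d := (c / Real.log m).toNNReal) ?_
  rw [Real.coe_toNNReal _ hd]
  refine ne_top_of_le_ne_top hsum ?_
  refine (Measure.hausdorffMeasure_le_liminf_tsum (β := ℕ) (ι := fun K => {i // K ≤ L i})
    (l := atTop) _ A (fun n => ENNReal.ofReal (Real.exp (-(Real.log m * n))))
    (tendsto_ofReal_exp_neg hlog) (fun _ i => t i) ?_ ?_).trans ?_
  · refine Eventually.of_forall fun K i => ?_
    exact ediam_le_of_agree fun x hx y hy j hj => hagree i x hx y hy j (hj.trans_le i.2)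
  · refine Eventually.of_forall fun K w hw => ?_
    obtain ⟨i, hi, hwi⟩ := hcover w hw K
    exact mem_iUnion.2 ⟨⟨i, hi⟩, hwi⟩
  -- Each sum over the indices with `K ≤ L i` is at most the full sum. A finite Hausdorff measure
  -- suffices, so no tail limit is needed.
  · refine liminf_le_of_le (by isBoundedDefault) fun b hb => ?_
    obtain ⟨K, hK⟩ := hb.exists
    refine hK.trans ?_
    refine le_trans (ENNReal.tsum_le_tsum fun i => ?_)
      (ENNReal.tsum_comp_le_tsum_of_injective (Subtype.val_injective (p := fun i => K ≤ L i))
        fun i => ENNReal.ofReal (Real.exp (-(c * L i))))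
    rw [← ofReal_exp_rpow (m := m)]
    exact ENNReal.rpow_le_rpow (ediam_le_of_agree (hagree i)) hd

/-- The mass distribution principle for cylinders. -/
theorem le_dimH_of_measure_cylinder_le {A : Set (ℕ → Fin m)} (μ : Measure (ℕ → Fin m))
    (hA : μ A ≠ 0) {c : ℝ} (hc : 0 < c) (L₀ : ℕ)
    (h : ∀ L ≥ L₀, ∀ w : ℕ → Fin m,
      μ {x | ∀ i < L, x i = w i} ≤ ENNReal.ofReal (Real.exp (-(c * (L + 1 : ℕ))))) :
    ENNReal.ofReal (c / Real.log m) ≤ dimH A := by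
  have hlog := log_card_pos (m := m)
  have hd : 0 ≤ c / Real.log m := by positivity
  refine le_dimH_of_hausdorffMeasure_ne_zero (d := (c / Real.log m).toNNReal) ?_
  rw [Real.coe_toNNReal _ hd]
  have key : μ ≤ Measure.hausdorffMeasure (c / Real.log m) := by
    refine Measure.le_hausdorffMeasure _ μ
      (ENNReal.ofReal (Real.exp (-(Real.log m * (L₀ + 1 : ℕ)))))
      (ENNReal.ofReal_pos.2 (Real.exp_pos _)) fun s hs => ?_
    rcases s.eq_empty_or_nonempty with rfl | ⟨w, hw⟩
    · simp
    have hsub : ∀ L : ℕ, Metric.ediam s < ENNReal.ofReal (Real.exp (-(Real.log m * L))) →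
        s ⊆ {x | ∀ i < L, x i = w i} := fun L hL x hx =>
      (edist_lt_iff x w L).1 ((Metric.edist_le_ediam_of_mem hx hw).trans_lt hL)
    rcases eq_or_ne (Metric.ediam s) 0 with h0 | h0
    · have : μ s ≤ 0 := by
        refine ge_of_tendsto ((tendsto_ofReal_exp_neg hc).comp (tendsto_add_atTop_nat 1)) ?_
        filter_upwards [eventually_ge_atTop L₀] with L hL
        refine (measure_mono (hsub L ?_)).trans (h L hL w)
        rw [h0]
        exact ENNReal.ofReal_pos.2 (Real.exp_pos _)
      exact this.trans zero_le
    -- For the least such L, the set s lies in a cylinder of length L - 1 while its diameter is at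
    -- least m^(-L). This shift explains the `L + 1` in the hypothesis.
    · have hex : ∃ L : ℕ, ENNReal.ofReal (Real.exp (-(Real.log m * L))) ≤ Metric.ediam s :=
        ((tendsto_ofReal_exp_neg hlog).eventually
          (eventually_le_nhds (pos_iff_ne_zero.2 h0))).exists
      classical
      obtain ⟨hL1, hL2⟩ := And.intro (Nat.find_spec hex) fun k => Nat.find_min (m := k) hex
      set L := Nat.find hex
      have hlt : L₀ < L := by
        by_contra hle
        have h1 : (L : ℝ) < (L₀ + 1 : ℕ) := by exact_mod_cast Nat.lt_succ_of_le (not_lt.1 hle)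
        refine absurd (hL1.trans hs) (not_le.2 ?_)
        rw [ENNReal.ofReal_lt_ofReal_iff (Real.exp_pos _), Real.exp_lt_exp]
        nlinarith
      obtain ⟨k, hk⟩ := Nat.exists_eq_succ_of_ne_zero (Nat.ne_zero_of_lt hlt)
      rw [hk] at hL1 hL2 hlt
      have h2 := hsub k (not_le.1 (hL2 k (Nat.lt_succ_self k)))
      refine (measure_mono h2).trans ((h k (Nat.le_of_lt_succ hlt) w).trans ?_)
      rw [← ofReal_exp_rpow (m := m)]
      exact ENNReal.rpow_le_rpow hL1 hd
  exact fun h0 => hA (le_antisymm ((key A).trans h0.le) zero_le)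

end HausdorffDimension

/-! ### Word counts and entropy -/

section Entropy

variable {m : ℕ} {S : SymbolicDynamics.FullShift.Subshift (Fin m) ℕ}

theorem ncard_words_pos {S : Set (ℕ → Fin m)} (hS : S.Nonempty) (n : ℕ) :
    0 < (words S n).ncard :=
  let ⟨u, hu⟩ := hS
  (ncard_pos (finite_words _ n)).2 ⟨_, u, hu, rfl⟩

theorem length_of_mem_words {S : Set (ℕ → Fin m)} {n : ℕ} {w : List (Fin m)}
    (hw : w ∈ words S n) : w.length = n := by
  obtain ⟨u, -, rfl⟩ := hw
  simp

theorem entropy_nonneg (S : Set (ℕ → Fin m)) : 0 ≤ entropy S := by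
  refine Real.sInf_nonneg ?_
  rintro _ ⟨n, -, rfl⟩
  exact div_nonneg (Real.log_natCast_nonneg _) (Nat.cast_nonneg _)

theorem exp_entropy_mul_le_ncard_words {S : Set (ℕ → Fin m)} (hS : S.Nonempty) (n : ℕ) :
    Real.exp (entropy S * n) ≤ (words S n).ncard := by
  have hpos : (0 : ℝ) < (words S n).ncard := by exact_mod_cast ncard_words_pos hS n
  rcases Nat.eq_zero_or_pos n with rfl | hn
  · simpa using Nat.one_le_iff_ne_zero.2 (ncard_words_pos hS 0).ne'
  rw [← Real.le_log_iff_exp_le hpos, ← le_div_iff₀ (by exact_mod_cast hn)]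
  refine csInf_le ⟨0, ?_⟩ ⟨n, hn, rfl⟩
  rintro _ ⟨k, -, rfl⟩
  exact div_nonneg (Real.log_natCast_nonneg _) (Nat.cast_nonneg _)

theorem exists_ncard_words_le {g : ℝ} (hg : entropy S.carrier < g) :
    ∃ C : ℝ, 0 < C ∧ ∀ n : ℕ, ((words S.carrier n).ncard : ℝ) ≤ C * Real.exp (g * n) := by
  obtain ⟨n₀, hn₀⟩ := eventually_atTop.1
    (((tendsto_entropy S).eventually (eventually_lt_nhds hg)).and (eventually_gt_atTop 0))
  have hg0 : 0 < g := (entropy_nonneg _).trans_lt hg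
  -- The entropy limit controls only n ≥ n₀; the sum absorbs the finitely many shorter lengths.
  refine ⟨1 + ∑ n ∈ Finset.range n₀, ((words S.carrier n).ncard : ℝ), by positivity, fun n => ?_⟩
  rcases lt_or_ge n n₀ with h | h
  · have h1 := Finset.single_le_sum (f := fun n => ((words S.carrier n).ncard : ℝ))
      (fun _ _ => Nat.cast_nonneg _) (Finset.mem_range.2 h)
    have h2 : 1 ≤ Real.exp (g * n) := Real.one_le_exp (by positivity)
    have h3 : (0 : ℝ) ≤ (words S.carrier n).ncard := Nat.cast_nonneg _
    nlinarith
  · obtain ⟨h1, h2⟩ := hn₀ n h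
    have h3 : ((words S.carrier n).ncard : ℝ) ≤ Real.exp (g * n) := by
      rcases Nat.eq_zero_or_pos (words S.carrier n).ncard with h0 | h0
      · rw [h0]; simpa using (Real.exp_pos _).le
      · rw [← Real.log_le_iff_le_exp (by exact_mod_cast h0)]
        exact ((div_lt_iff₀ (by exact_mod_cast h2)).1 h1).le
    refine h3.trans (le_mul_of_one_le_left (Real.exp_pos _).le ?_)
    exact le_add_of_nonneg_right (Finset.sum_nonneg fun _ _ => Nat.cast_nonneg _)

theorem tsum_ofReal_exp_ne_top {a : ℝ} (ha : 0 < a) :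
    ∑' n : ℕ, ENNReal.ofReal (Real.exp (-(a * n))) ≠ ⊤ := by
  have h : ∀ n : ℕ, ENNReal.ofReal (Real.exp (-(a * n))) =
      ENNReal.ofReal (Real.exp (-a)) ^ n := fun n => by
    rw [← ENNReal.ofReal_pow (Real.exp_pos _).le, ← Real.exp_nat_mul]
    congr 2
    ring
  simp_rw [h, ENNReal.tsum_geometric]
  refine ENNReal.inv_ne_top.2 (tsub_pos_iff_lt.2 ?_).ne'
  rw [ENNReal.ofReal_lt_one]
  exact Real.exp_lt_one_iff.2 (by linarith)

theorem tsum_ncard_words_ne_top {g : ℝ} (hg : entropy S.carrier < g) :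
    ∑' n : ℕ, ((words S.carrier n).ncard : ENNReal) * ENNReal.ofReal (Real.exp (-(g * n))) ≠ ⊤ := by
  obtain ⟨g', h1, h2⟩ := exists_between hg
  obtain ⟨C, hC, hN⟩ := exists_ncard_words_le h1
  have h3 := ENNReal.mul_ne_top (ENNReal.ofReal_ne_top (r := C))
    (tsum_ofReal_exp_ne_top (sub_pos.2 h2))
  rw [← ENNReal.tsum_mul_left] at h3
  refine ne_top_of_le_ne_top h3 (ENNReal.tsum_le_tsum fun n => ?_)
  rw [← ENNReal.ofReal_natCast, ← ENNReal.ofReal_mul (Nat.cast_nonneg _),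
    ← ENNReal.ofReal_mul hC.le]
  refine ENNReal.ofReal_le_ofReal ?_
  calc _ ≤ C * Real.exp (g' * n) * Real.exp (-(g * n)) := by gcongr; exact hN n
    _ = _ := by rw [mul_assoc, ← Real.exp_add]; congr 2; ring

/-- Summation over all words of a subshift, grouped by length. -/
theorem tsum_sigma_words {S : Set (ℕ → Fin m)} (f : ℕ → ENNReal) :
    ∑' p : (Σ n, words S n), f p.1 = ∑' n, ((words S n).ncard : ENNReal) * f n := by
  rw [ENNReal.tsum_sigma']
  refine tsum_congr fun n => ?_
  have h : ((words S n).encard : ENNReal) = (words S n).ncard := by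
    rw [← (finite_words S n).cast_ncard_eq, ENat.toENNReal_coe]
  simp [ENNReal.tsum_const, h]

end Entropy

theorem ofFn_mem_words {m : ℕ} {S : SymbolicDynamics.FullShift.Subshift (Fin m) ℕ}
    {u : ℕ → Fin m} (hu : u ∈ S.carrier) (a n : ℕ) :
    (List.ofFn fun i : Fin n => u (a + i)) ∈ words S.carrier n :=
  ⟨_, S.mapsTo a hu, rfl⟩

/-- All cylinders of the subshift form a cover with summable weights for every g above the entropy;
then g decreases to it. -/
theorem dimH_subshift_le {m : ℕ} [m.AtLeastTwo]
    (S : SymbolicDynamics.FullShift.Subshift (Fin m) ℕ) :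
    dimH S.carrier ≤ ENNReal.ofReal (entropy S.carrier / Real.log m) := by
  have hlog := log_card_pos (m := m)
  have key : ∀ g > entropy S.carrier, dimH S.carrier ≤ ENNReal.ofReal (g / Real.log m) := by
    intro g hg
    have hc : ∀ n, Countable (words S.carrier n) := fun n => (finite_words _ n).countable
    refine dimH_le_of_tsum_ne_top (ι := Σ n, words S.carrier n)
      (fun p => {u | (List.ofFn fun i : Fin p.1 => u i) = p.2}) (fun p => p.1)
      ((entropy_nonneg _).trans hg.le) ?_ ?_ ?_
    · intro p x hx y hy j hj
      exact congrFun (List.ofFn_injective (hx.trans (Eq.symm hy))) ⟨j, hj⟩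
    · exact fun w hw K => ⟨⟨K, _, w, hw, rfl⟩, le_rfl, rfl⟩
    · rw [tsum_sigma_words fun n => ENNReal.ofReal (Real.exp (-(g * n)))]
      exact tsum_ncard_words_ne_top hg
  have hlim : Tendsto (fun g : ℝ => ENNReal.ofReal (g / Real.log m)) (𝓝[>] entropy S.carrier)
      (𝓝 (ENNReal.ofReal (entropy S.carrier / Real.log m))) :=
    ENNReal.tendsto_ofReal ((tendsto_id.div_const _).mono_left nhdsWithin_le_nhds)
  exact ge_of_tendsto hlim (eventually_mem_nhdsWithin.mono key)

/-! ### Multiplicative weights on lists and the proportion outside the runs -/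

theorem tsum_finTuple_prod {α : Type*} (f : α → ENNReal) (n : ℕ) :
    ∑' v : Fin n → α, ∏ i, f (v i) = (∑' a, f a) ^ n := by
  induction n with
  | zero => simp
  | succ n ih =>
    rw [← (Fin.consEquiv fun _ : Fin (n + 1) => α).tsum_eq, ENNReal.tsum_prod', pow_succ', ← ih,
      ← ENNReal.tsum_mul_right]
    refine tsum_congr fun a => ?_
    rw [← ENNReal.tsum_mul_left]
    refine tsum_congr fun v => ?_
    simp [Fin.consEquiv, Fin.prod_univ_succ]

/-- The sum over all finite lists of a multiplicative weight is a geometric series. -/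
theorem tsum_list_prod {α : Type*} (f : α → ENNReal) :
    ∑' l : List α, (l.map f).prod = (1 - ∑' a, f a)⁻¹ := by
  rw [← (List.equivSigmaTuple (α := α)).symm.tsum_eq, ENNReal.tsum_sigma', ← ENNReal.tsum_geometric]
  refine tsum_congr fun n => ?_
  rw [← tsum_finTuple_prod]
  refine tsum_congr fun v => ?_
  simp [List.equivSigmaTuple, List.map_ofFn, List.prod_ofFn]

/-- If block lengths `x k` dominate `τ` times the position of the next block, then infinitely often
the proportion of the part outside the blocks is at most any `D > ((1 - τ) / (1 + τ)) ^ 2`. -/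
theorem exists_sub_sum_le {τ D : ℝ} (hτ0 : 0 < τ) (hτ1 : τ < 1)
    (hD : (1 - τ) ^ 2 < D * (1 + τ) ^ 2) (hD1 : D < 1) {n x : ℕ → ℝ} (hx : ∀ k, 0 < x k)
    (hn : ∀ k, τ * n (k + 1) ≤ x k) (K : ℕ) :
    ∃ k ≥ K, n k - ∑ j ∈ Finset.range k, x j ≤ D * (n k + x k) := by
  by_contra! hcon
  have hD0 : 0 < D := by
    by_contra h
    nlinarith [sq_nonneg (1 - τ), sq_nonneg (1 + τ)]
  set Y : ℕ → ℝ := fun k => ∑ j ∈ Finset.range k, x j with hY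
  have hYs : ∀ k, Y (k + 1) = Y k + x k := fun k => Finset.sum_range_succ _ _
  have hYpos : ∀ k, 0 < Y (k + 1) := fun k =>
    Finset.sum_pos (fun j _ => hx j) (by simp)
  -- If the claim fails from K on, inserting n (k+1) ≤ x k / τ gives D Y(k+2) < B Y(k+1) - C Y(k)
  -- for the partial sums Y. The hypothesis on D says exactly that B² - 4DC < 0, and such a
  -- recursion cannot stay positive.
  set C : ℝ := (1 - D) / τ with hC
  have hCτ : C * τ = 1 - D := by rw [hC]; field_simp
  have hC0 : 0 < C := div_pos (by linarith) hτ0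
  set B : ℝ := C * (1 - τ) with hB
  have hB0 : 0 < B := mul_pos hC0 (by linarith)
  have hdisc : B ^ 2 < 4 * D * C := by
    have : C * (1 - τ) ^ 2 < 4 * D := by
      rw [hC, div_mul_eq_mul_div, div_lt_iff₀ hτ0]
      nlinarith
    rw [hB]
    nlinarith
  set δ : ℝ := Real.sqrt (4 * D * C) - B with hδ
  have hδ0 : 0 < δ := sub_pos.2 (Real.lt_sqrt_of_sq_lt hdisc)
  have hsq : (B + δ) ^ 2 = 4 * D * C := by
    rw [hδ, add_sub_cancel, Real.sq_sqrt (by positivity)]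
  set r : ℕ → ℝ := fun k => Y (k + 1) / Y k with hr
  -- With r the ratio of consecutive partial sums, the recursion reads D r' < B - C / r. By AM-GM, D
  -- r + C / r ≥ 2√(DC) = B + δ, so the ratio drops by at least δ / D at every step and would become
  -- negative.
  have hstep : ∀ k ≥ K, r (k + 2) ≤ r (k + 1) - δ / D := by
    intro k hk
    have h1 := hcon (k + 2) (by omega)
    have h2 := hn (k + 1)
    have h3 : n (k + 2) ≤ x (k + 1) / τ := (le_div_iff₀ hτ0).2 (by linarith)
    have e1 := hYs (k + 2)
    have e2 := hYs (k + 1)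
    have p1 := hYpos k
    have p2 := hYpos (k + 1)
    have h4 : (1 - D) * n (k + 2) ≤ C * x (k + 1) := by
      rw [hC, div_mul_eq_mul_div, ← mul_div_assoc']
      exact mul_le_mul_of_nonneg_left h3 (by linarith)
    have h5 : D * Y (k + 3) < B * Y (k + 2) - C * Y (k + 1) := by
      have hB' : B = C + D - 1 := by rw [hB]; linarith
      rw [hB']
      change D * Y (k + 2 + 1) < _
      have h1' : D * (n (k + 2) + x (k + 2)) < n (k + 2) - Y (k + 2) := h1
      have e2' : Y (k + 2) = Y (k + 1) + x (k + 1) := e2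
      nlinarith
    have h6 : (B + δ) * (Y (k + 2) * Y (k + 1)) ≤ D * Y (k + 2) ^ 2 + C * Y (k + 1) ^ 2 := by
      nlinarith [sq_nonneg (2 * D * Y (k + 2) - (B + δ) * Y (k + 1))]
    change Y (k + 3) / Y (k + 2) ≤ Y (k + 2) / Y (k + 1) - δ / D
    rw [div_sub_div _ _ p1.ne' hD0.ne', div_le_div_iff₀ p2 (by positivity)]
    have h7 := mul_lt_mul_of_pos_right h5 p1
    change 0 < Y (k + 2) at p2
    nlinarith
  have hlin : ∀ j : ℕ, r (K + 1 + j) ≤ r (K + 1) - j * (δ / D) := by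
    intro j
    induction j with
    | zero => simp
    | succ j ih =>
      have := hstep (K + j) (by omega)
      rw [show K + 1 + (j + 1) = K + j + 2 by ring]
      rw [show K + 1 + j = K + j + 1 by ring] at ih
      push_cast
      linarith
  obtain ⟨j, hj⟩ := exists_nat_gt (r (K + 1) / (δ / D))
  rw [div_lt_iff₀ (by positivity)] at hj
  have h8 := hlin j
  have h9 : 0 < r (K + 1 + j) := by
    rw [show K + 1 + j = K + j + 1 by ring]
    exact div_pos (hYpos _) (hYpos _)
  linarith

/-! ### Record zero runs -/

section ZeroRuns

variable {m : ℕ} [NeZero m]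

/-- Record zero runs of a sequence with infinitely many nonzero letters: if every window
`[0, N]`, `N ≥ N₀`, contains the start of a zero run of length `≥ τ (N + 1)`, there are disjoint
zero runs `[n k, n k + x k)` with `τ * n (k + 1) ≤ x k`. -/
theorem exists_record_zero_runs {u : ℕ → Fin m} (hu : ∀ n, ∃ i, u (n + i) ≠ 0) {τ : ℝ} (hτ : 0 < τ)
    {N₀ : ℕ} (hit : ∀ N ≥ N₀, ∃ n ≤ N, ∃ p : ℕ, τ * (N + 1) ≤ p ∧ ∀ i < p, u (n + i) = 0) (T : ℕ) :
    ∃ n x : ℕ → ℕ, (∀ k, T ≤ x k) ∧ (∀ k, ∀ i < x k, u (n k + i) = 0) ∧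
      (∀ k, n k + x k ≤ n (k + 1)) ∧ ∀ k, τ * n (k + 1) ≤ x k := by
  classical
  set R : ℕ → ℕ := fun n => Nat.find (hu n) with hR
  have hRne : ∀ n, u (n + R n) ≠ 0 := fun n => Nat.find_spec (hu n)
  have hR0 : ∀ n, ∀ i < R n, u (n + i) = 0 := fun n i hi => not_not.1 (Nat.find_min (hu n) hi)
  have hRle : ∀ n p, (∀ i < p, u (n + i) = 0) → p ≤ R n := fun n p hp =>
    not_lt.1 fun hlt => hRne n (hp _ hlt)
  -- The hitting condition at N = ⌊y / τ⌋ gives a run of length at least τ (N + 1) > y starting at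
  -- some n ≤ y / τ.
  have hnext : ∀ y : ℕ, τ * N₀ ≤ y → ∃ n, y < R n ∧ τ * n ≤ y := by
    intro y hy
    obtain ⟨n, hn, p, hp, hz⟩ := hit ⌊y / τ⌋₊ (Nat.le_floor ((le_div_iff₀ hτ).2 (by linarith)))
    refine ⟨n, lt_of_lt_of_le ?_ (hRle n p hz), ?_⟩
    · have h1 := Nat.lt_floor_add_one (y / τ)
      rw [div_lt_iff₀ hτ] at h1
      exact_mod_cast (show (y : ℝ) < p by linarith)
    · have h1 : (n : ℝ) ≤ y / τ := (Nat.cast_le.2 hn).trans (Nat.floor_le (by positivity))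
      rw [le_div_iff₀ hτ] at h1
      linarith
  set T' := max T ⌈τ * N₀⌉₊ with hT'
  have hT'le : ∀ y, T' ≤ y → τ * N₀ ≤ (y : ℝ) := fun y hy =>
    (Nat.le_ceil _).trans (Nat.cast_le.2 ((le_max_right _ _).trans hy))
  -- Strict records: the run from n is longer than that from any earlier position. The successor of
  -- a record a is the first position whose run exceeds `R a`.
  let Good : ℕ → Prop := fun n => T' ≤ R n ∧ ∀ i < n, R i < R n
  have hfirst : ∃ n, Good n := by
    obtain ⟨n, hn, -⟩ := hnext T' (hT'le _ le_rfl)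
    have hex : ∃ n, T' < R n := ⟨n, hn⟩
    exact ⟨Nat.find hex, (Nat.find_spec hex).le, fun i hi =>
      (not_lt.1 (Nat.find_min hex hi)).trans_lt (Nat.find_spec hex)⟩
  have hsucc : ∀ a : {n // Good n}, ∃ b : {n // Good n},
      a.1 + R a.1 ≤ b.1 ∧ τ * (b.1 : ℝ) ≤ R a.1 := by
    rintro ⟨a, haT, ha⟩
    obtain ⟨n, hn, hn'⟩ := hnext (R a) (hT'le _ haT)
    have hex : ∃ n, R a < R n := ⟨n, hn⟩
    have hspec := Nat.find_spec hex
    refine ⟨⟨Nat.find hex, haT.trans hspec.le, fun i hi =>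
      (not_lt.1 (Nat.find_min hex hi)).trans_lt hspec⟩, ?_, ?_⟩
    -- A longer run starting inside the run of a would cover position a + R a, where the letter is
    -- nonzero.
    · by_contra! hlt
      simp only at hlt
      rcases lt_or_ge (Nat.find hex) a with h | h
      · exact absurd hspec (not_lt.2 (ha _ h).le)
      · have h0 := hR0 (Nat.find hex) (a + R a - Nat.find hex) (by omega)
        rw [show Nat.find hex + (a + R a - Nat.find hex) = a + R a by omega] at h0
        exact hRne a h0
    · refine le_trans (mul_le_mul_of_nonneg_left ?_ hτ.le) hn'
      exact_mod_cast Nat.find_min' hex hn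
  obtain ⟨a₀, ha₀⟩ := hfirst
  choose next hnext1 hnext2 using hsucc
  let s : ℕ → {n // Good n} := fun k => Nat.rec ⟨a₀, ha₀⟩ (fun _ => next) k
  exact ⟨fun k => (s k).1, fun k => R (s k).1, fun k => (le_max_left _ _).trans (s k).2.1,
    fun k => hR0 _, fun k => hnext1 (s k), fun k => hnext2 (s k)⟩

/-- These points have an infinite zero run and hence no infinite sequence of records; being
countable in number, they do not affect the dimension. -/
theorem countable_eventually_zero :
    {u : ℕ → Fin m | ∃ n, ∀ i, u (n + i) = 0}.Countable := by
  have : {u : ℕ → Fin m | ∃ n, ∀ i, u (n + i) = 0} =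
      ⋃ n, {u : ℕ → Fin m | ∀ i, u (n + i) = 0} := by
    ext; simp
  rw [this]
  refine countable_iUnion fun n => Set.Finite.countable ?_
  refine Set.Finite.of_finite_image (f := fun u (i : Fin n) => u i) (Set.toFinite _) ?_
  intro u hu v hv huv
  funext i
  rcases lt_or_ge i n with h | h
  · exact congrFun huv ⟨i, h⟩
  · rw [show i = n + (i - n) by omega]
    exact (hu _).trans (hv _).symm

end ZeroRuns

/-- The finite word `u a, u (a + 1), …, u (a + n - 1)`. -/
def subword {α : Type*} (u : ℕ → α) (a n : ℕ) : List α :=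
  List.ofFn fun i : Fin n => u (a + i)

@[simp] theorem length_subword {α : Type*} (u : ℕ → α) (a n : ℕ) : (subword u a n).length = n := by
  simp [subword]

theorem subword_add {α : Type*} (u : ℕ → α) (a n k : ℕ) :
    subword u a (n + k) = subword u a n ++ subword u (a + n) k := by
  refine List.ext_getElem (by simp) fun i h1 h2 => ?_
  rw [List.getElem_append]
  simp only [subword, List.getElem_ofFn, List.length_ofFn]
  split_ifs with h
  · rfl
  · congr 1
    omega

theorem subword_mem_words {m : ℕ} {S : SymbolicDynamics.FullShift.Subshift (Fin m) ℕ}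
    {u : ℕ → Fin m} (hu : u ∈ S.carrier) (a n : ℕ) : subword u a n ∈ words S.carrier n :=
  ofFn_mem_words hu a n

theorem eq_of_subword_eq {α : Type*} {u v : ℕ → α} {a n : ℕ} (h : subword u a n = subword v a n)
    {i : ℕ} (hi : i < n) : u (a + i) = v (a + i) :=
  congrFun (List.ofFn_injective h) ⟨i, hi⟩

/-- A word of the subshift together with a number, read as the word followed by at least `T`
zeros. -/
abbrev Block {m : ℕ} (S : Set (ℕ → Fin m)) : Type := (Σ n, words S n) × ℕ

/-! ### Prefixes spelled by blocks and their weights -/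

section Blocks

variable {m : ℕ} {S : Set (ℕ → Fin m)}

/-- The word spelled by a list of blocks. -/
def blockWord [NeZero m] (T : ℕ) (l : List (Block S)) : List (Fin m) :=
  l.flatMap fun p => (p.1.2 : List (Fin m)) ++ List.replicate (T + p.2) 0

/-- The total length of the free parts of a list of blocks. -/
def freeLength (l : List (Block S)) : ℕ := (l.map fun p => p.1.1).sum

/-- The total length of the zero parts of a list of blocks. -/
def zeroLength (T : ℕ) (l : List (Block S)) : ℕ := (l.map fun p => T + p.2).sum

/-- The weight of a block. -/
noncomputable def blockWeight (g η : ℝ) (T : ℕ) (p : Block S) : ENNReal :=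
  ENNReal.ofReal (Real.exp (-(g * p.1.1))) * ENNReal.ofReal (Real.exp (-(η * (T + p.2 : ℕ))))

theorem length_blockWord [NeZero m] (T : ℕ) (l : List (Block S)) :
    (blockWord T l).length = freeLength l + zeroLength T l := by
  induction l with
  | nil => rfl
  | cons p l ih =>
    have := length_of_mem_words p.1.2.2
    simp only [blockWord, freeLength, zeroLength, List.flatMap_cons, List.length_append,
      List.length_replicate, List.map_cons, List.sum_cons] at ih ⊢
    omega

theorem prod_blockWeight (g η : ℝ) (T : ℕ) (l : List (Block S)) :
    (l.map (blockWeight g η T)).prod =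
      ENNReal.ofReal (Real.exp (-(g * freeLength l + η * zeroLength T l))) := by
  induction l with
  | nil => simp [freeLength, zeroLength]
  | cons p l ih =>
    rw [List.map_cons, List.prod_cons, ih, blockWeight, ← ENNReal.ofReal_mul (Real.exp_pos _).le,
      ← Real.exp_add, ← ENNReal.ofReal_mul (Real.exp_pos _).le, ← Real.exp_add]
    simp only [freeLength, zeroLength, List.map_cons, List.sum_cons, Nat.cast_add]
    congr 2
    ring

/-- A sequence with long disjoint zero runs has prefixes spelled by blocks. -/
theorem exists_blockWord_eq [NeZero m] {S : SymbolicDynamics.FullShift.Subshift (Fin m) ℕ}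
    {u : ℕ → Fin m} (hu : u ∈ S.carrier) {T : ℕ} {n x : ℕ → ℕ} (hT : ∀ k, T ≤ x k)
    (hz : ∀ k, ∀ i < x k, u (n k + i) = 0) (hn : ∀ k, n k + x k ≤ n (k + 1)) (k : ℕ) :
    ∃ l : List (Block S.carrier), blockWord T l = subword u 0 (n k + x k) ∧
      freeLength l + ∑ j ∈ Finset.range k, x j = n k := by
  have hzero : ∀ k, subword u (n k) (x k) = List.replicate (x k) 0 := fun k => by
    refine List.ext_getElem (by simp) fun i h1 h2 => ?_
    simp only [subword, List.getElem_ofFn, List.getElem_replicate]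
    exact hz k i (by simpa using h1)
  induction k with
  | zero =>
    refine ⟨[(⟨n 0, _, subword_mem_words hu 0 (n 0)⟩, x 0 - T)], ?_, ?_⟩
    · rw [subword_add, zero_add, hzero]
      simp [blockWord, Nat.add_sub_cancel' (hT 0)]
    · simp [freeLength]
  | succ k ih =>
    obtain ⟨l, h1, h2⟩ := ih
    have hk := hn k
    refine ⟨l ++ [(⟨_, _, subword_mem_words hu (n k + x k) (n (k + 1) - (n k + x k))⟩,
      x (k + 1) - T)], ?_, ?_⟩
    · rw [subword_add, zero_add, hzero, show subword u 0 (n (k + 1)) =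
        subword u 0 (n k + x k + (n (k + 1) - (n k + x k))) by rw [Nat.add_sub_cancel' hk],
        subword_add, ← h1]
      simp [blockWord, Nat.add_sub_cancel' (hT (k + 1))]
    · rw [Finset.sum_range_succ]
      simp only [freeLength, List.map_append, List.sum_append, List.map_cons, List.map_nil,
        List.sum_cons, List.sum_nil] at h2 ⊢
      omega

/-- The sum factors as e^(-ηT) times a finite constant, so long compulsory zero runs make it small.
This is the condition under which the geometric series over lists converges. -/
theorem exists_tsum_blockWeight_lt_one {S : SymbolicDynamics.FullShift.Subshift (Fin m) ℕ}
    {g η : ℝ} (hg : entropy S.carrier < g) (hη : 0 < η) :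
    ∃ T : ℕ, 0 < T ∧ ∑' p : Block S.carrier, blockWeight g η T p < 1 := by
  set Q := (∑' n : ℕ, ((words S.carrier n).ncard : ENNReal) *
    ENNReal.ofReal (Real.exp (-(g * n)))) * ∑' n : ℕ, ENNReal.ofReal (Real.exp (-(η * n))) with hQ
  have hQtop : Q ≠ ⊤ := ENNReal.mul_ne_top (tsum_ncard_words_ne_top hg) (tsum_ofReal_exp_ne_top hη)
  have hsum : ∀ T : ℕ, ∑' p : Block S.carrier, blockWeight g η T p =
      ENNReal.ofReal (Real.exp (-(η * T))) * Q := by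
    intro T
    rw [hQ, ← tsum_sigma_words fun n => ENNReal.ofReal (Real.exp (-(g * n))),
      ← ENNReal.tsum_mul_right, ← ENNReal.tsum_mul_left, ENNReal.tsum_prod']
    refine tsum_congr fun p => ?_
    rw [← mul_assoc, ← ENNReal.tsum_mul_left]
    refine tsum_congr fun y => ?_
    rw [blockWeight, mul_comm (ENNReal.ofReal (Real.exp (-(η * T)))), mul_assoc]
    congr 1
    rw [← ENNReal.ofReal_mul (Real.exp_pos _).le, ← Real.exp_add]
    congr 2
    push_cast
    ring
  have hlim : Tendsto (fun T : ℕ => ENNReal.ofReal (Real.exp (-(η * T))) * Q) atTop (𝓝 (0 * Q)) :=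
    ENNReal.Tendsto.mul_const (tendsto_ofReal_exp_neg hη) (Or.inr hQtop)
  rw [zero_mul] at hlim
  obtain ⟨T, hT, hT0⟩ :=
    ((hlim.eventually (eventually_lt_nhds zero_lt_one)).and (eventually_gt_atTop 0)).exists
  exact ⟨T, hT0, (hsum T).trans_lt hT⟩

end Blocks

/-- Points of `S` such that every long enough window `[0, N]` contains the start of a zero run of
length at least `τ (N + 1)`. -/
def uniformZeroRuns {m : ℕ} [NeZero m] (S : Set (ℕ → Fin m)) (τ : ℝ) : Set (ℕ → Fin m) :=
  {u ∈ S | ∀ᶠ N : ℕ in atTop, ∃ n ≤ N, ∃ p : ℕ, τ * (N + 1) ≤ p ∧ ∀ i < p, u (n + i) = 0}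

theorem dimH_uniformZeroRuns_le {m : ℕ} [m.AtLeastTwo]
    (S : SymbolicDynamics.FullShift.Subshift (Fin m) ℕ) {τ : ℝ} (hτ0 : 0 < τ) (hτ1 : τ < 1) :
    dimH (uniformZeroRuns S.carrier τ) ≤
      ENNReal.ofReal (((1 - τ) / (1 + τ)) ^ 2 * entropy S.carrier / Real.log m) := by
  have hlog := log_card_pos (m := m)
  have hent := entropy_nonneg S.carrier
  set D₀ := ((1 - τ) / (1 + τ)) ^ 2 with hD₀
  have hD₀0 : 0 ≤ D₀ := sq_nonneg _
  have hD₀1 : D₀ < 1 := by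
    rw [hD₀, div_pow, div_lt_one (by positivity)]
    nlinarith
  have key : ∀ ε > 0, D₀ + ε < 1 → dimH (uniformZeroRuns S.carrier τ) ≤
      ENNReal.ofReal (((entropy S.carrier + ε) * (D₀ + ε) + ε) / Real.log m) := by
    intro ε hε hε1
    set D := D₀ + ε with hD
    set g := entropy S.carrier + ε with hg
    have hg0 : 0 < g := by positivity
    have hDlt : (1 - τ) ^ 2 < D * (1 + τ) ^ 2 := by
      have : D₀ * (1 + τ) ^ 2 = (1 - τ) ^ 2 := by rw [hD₀]; field_simp
      have : 0 < ε * (1 + τ) ^ 2 := by positivity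
      rw [hD]; nlinarith
    obtain ⟨T, hT0, hT⟩ := exists_tsum_blockWeight_lt_one (S := S) (g := g) (by linarith) hε
    have hcover : dimH (uniformZeroRuns S.carrier τ \ {u | ∃ n, ∀ i, u (n + i) = 0}) ≤
        ENNReal.ofReal ((g * D + ε) / Real.log m) := by
      have hc : ∀ n, Countable (words S.carrier n) := fun n => (finite_words _ n).countable
      refine dimH_le_of_tsum_ne_top
        -- Only block lists with free proportion at most D serve as indices. Different lists may
        -- spell the same word, which only enlarges the sum.
        (ι := {l : List (Block S.carrier) //
          (freeLength l : ℝ) ≤ D * (freeLength l + zeroLength T l : ℕ)})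
        (fun l => {u | subword u 0 (freeLength l.1 + zeroLength T l.1) =
          blockWord T l.1})
        (fun l => freeLength l.1 + zeroLength T l.1) (by positivity) ?_ ?_ ?_
      · intro l x hx y hy j hj
        simpa using eq_of_subword_eq (hx.trans (Eq.symm hy)) hj
      · rintro u ⟨⟨huS, hit⟩, hu⟩ K
        simp only [mem_ofPred_eq, not_exists, not_forall] at hu
        obtain ⟨N₀, hN₀⟩ := eventually_atTop.1 hit
        obtain ⟨n, x, hTx, hz, hn, hnx⟩ := exists_record_zero_runs hu hτ0 hN₀ T
        obtain ⟨k, hk, hfree⟩ := exists_sub_sum_le (x := fun k => (x k : ℝ))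
          (n := fun k => (n k : ℝ)) hτ0 hτ1 hDlt hε1
          (fun k => by exact_mod_cast (hT0).trans_le (hTx k)) hnx K
        obtain ⟨l, hl1, hl2⟩ := exists_blockWord_eq huS hTx hz hn k
        have hlen : freeLength l + zeroLength T l = n k + x k := by
          rw [← length_blockWord, hl1, length_subword]
        have hpre : subword u 0 (freeLength l + zeroLength T l) = blockWord T l := by
          rw [hlen, hl1]
        have hKn : ∀ k, k ≤ n k + x k := fun k => by
          induction k with
          | zero => exact Nat.zero_le _
          | succ k ih =>
            have := hn k
            have := hTx (k + 1)
            omega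
        refine ⟨⟨l, ?_⟩, ?_, ?_⟩
        · have h2 : (freeLength l : ℝ) + ∑ j ∈ Finset.range k, (x j : ℝ) = n k := by
            exact_mod_cast hl2
          rw [hlen]
          push_cast
          linarith
        · rw [hlen]
          exact hk.le.trans (hKn k)
        · exact hpre
      · refine ne_top_of_le_ne_top
          (b := ∑' l : List (Block S.carrier), (l.map (blockWeight g ε T)).prod) ?_ ?_
        · rw [tsum_list_prod]
          exact ENNReal.inv_ne_top.2 (tsub_pos_iff_lt.2 hT).ne'
        · refine le_trans (ENNReal.tsum_le_tsum fun l => ?_)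
            (ENNReal.tsum_comp_le_tsum_of_injective Subtype.val_injective _)
          rw [prod_blockWeight]
          refine ENNReal.ofReal_le_ofReal (Real.exp_le_exp.2 (neg_le_neg ?_))
          -- With total length L, free length ≤ D L and zero length ≤ L, so g · free + ε · zero ≤ (g
          -- D + ε) L.
          have h1 := mul_le_mul_of_nonneg_left l.2 hg0.le
          have h2 : 0 ≤ ε * (freeLength l.1 : ℝ) := by positivity
          push_cast at h1 ⊢
          nlinarith
    refine (dimH_mono (subset_sdiff_union _ {u | ∃ n, ∀ i, u (n + i) = 0})).trans ?_
    rw [dimH_union, countable_eventually_zero.dimH_zero]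
    exact max_le hcover zero_le
  have hlim : Tendsto (fun ε : ℝ => ENNReal.ofReal
      (((entropy S.carrier + ε) * (D₀ + ε) + ε) / Real.log m)) (𝓝[>] 0)
      (𝓝 (ENNReal.ofReal (D₀ * entropy S.carrier / Real.log m))) := by
    refine ENNReal.tendsto_ofReal (tendsto_nhdsWithin_of_tendsto_nhds ?_)
    have : Continuous fun ε : ℝ => ((entropy S.carrier + ε) * (D₀ + ε) + ε) / Real.log m := by
      fun_prop
    simpa [mul_comm] using this.tendsto 0
  refine ge_of_tendsto hlim ?_
  filter_upwards [self_mem_nhdsWithin,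
    mem_nhdsWithin_of_mem_nhds (Iio_mem_nhds (sub_pos.2 hD₀1))] with ε h1 h2
  exact key ε h1 (by simp only [mem_Iio] at h2; linarith)

/-! ### Coding points by free words under specification -/

section Coding

variable {m : ℕ}

theorem mem_language_of_mem_words {S : Set (ℕ → Fin m)} {n : ℕ} (hn : 0 < n) {w : List (Fin m)}
    (hw : w ∈ words S n) : w ∈ language S :=
  mem_iUnion₂.2 ⟨n, hn, hw⟩

theorem exists_subword_eq_of_mem_language {S : Set (ℕ → Fin m)} {w : List (Fin m)}
    (hw : w ∈ language S) : ∃ u ∈ S, w = subword u 0 w.length := by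
  obtain ⟨n, -, u, hu, rfl⟩ := mem_iUnion₂.1 hw
  refine ⟨u, hu, ?_⟩
  simp [subword]

/-- Prefixes built from free words `a k` and zero blocks of length `x k`, consecutive pieces being
joined by connecting words `gap`. -/
def codedPrefix [NeZero m] (gap : List (Fin m) → List (Fin m) → List (Fin m)) (n₀ : ℕ) (x : ℕ → ℕ)
    (a : ℕ → List (Fin m)) : ℕ → List (Fin m)
  | 0 => List.replicate (n₀ + x 0) 0
  | k + 1 =>
    let q := codedPrefix gap n₀ x a k ++ gap (codedPrefix gap n₀ x a k) (a k) ++ a k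
    q ++ gap q (List.replicate (x (k + 1)) 0) ++ List.replicate (x (k + 1)) 0

instance {S : Set (ℕ → Fin m)} {n : ℕ} : MeasurableSpace (words S n) := ⊤

instance {S : Set (ℕ → Fin m)} {n : ℕ} : DiscreteMeasurableSpace (words S n) := ⟨fun _ => trivial⟩

instance {S : Set (ℕ → Fin m)} {n : ℕ} : Finite (words S n) := (finite_words S n).to_subtype

/-- Under specification, arbitrary words of prescribed lengths can be placed at prescribed positions
of a point of the subshift, with zero blocks between them. -/
theorem exists_coding [NeZero m] (S : SymbolicDynamics.FullShift.Subshift (Fin m) ℕ) {M : ℕ}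
    (hM : ∀ u ∈ language S.carrier, ∀ v ∈ language S.carrier,
      ∃ w ∈ words S.carrier M, u ++ w ++ v ∈ language S.carrier)
    (hzero : zeroSeq ∈ S.carrier) {n x l : ℕ → ℕ} (hx : ∀ k, 0 < x k) (hl : ∀ k, 0 < l k)
    (hn : ∀ k, n (k + 1) = n k + x k + M + l k + M) :
    ∃ Φ : (∀ k, words S.carrier (l k)) → ℕ → Fin m, Measurable Φ ∧ ∀ a, Φ a ∈ S.carrier ∧
      (∀ k, subword (Φ a) (n k + x k + M) (l k) = a k) ∧
      ∀ k, ∀ i < x k, Φ a (n k + i) = 0 := by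
  -- A total choice of connecting words, with the empty word as junk value. It depends on the whole
  -- prefix, but its length M does not, so positions are independent of the coded words.
  have hgap : ∀ u v : List (Fin m), ∃ w, u ∈ language S.carrier → v ∈ language S.carrier →
      w.length = M ∧ u ++ w ++ v ∈ language S.carrier := by
    intro u v
    by_cases h : u ∈ language S.carrier ∧ v ∈ language S.carrier
    · obtain ⟨w, hw, hw'⟩ := hM u h.1 v h.2
      exact ⟨w, fun _ _ => ⟨length_of_mem_words hw, hw'⟩⟩
    · exact ⟨[], fun h1 h2 => (h ⟨h1, h2⟩).elim⟩
  choose gap hgap using hgap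
  have hrep : ∀ k, 0 < k → List.replicate k 0 ∈ language S.carrier := fun k hk =>
    mem_language_of_mem_words hk ⟨zeroSeq, hzero, by simp [zeroSeq]⟩
  have hlang : ∀ k, ∀ w : words S.carrier (l k), (w : List (Fin m)) ∈ language S.carrier :=
    fun k w => mem_language_of_mem_words (hl k) w.2
  let pre : (∀ k, words S.carrier (l k)) → ℕ → List (Fin m) := fun a =>
    codedPrefix gap (n 0) x fun k => a k
  have hpres : ∀ a k, pre a (k + 1) = pre a k ++ gap (pre a k) (a k) ++ (a k : List (Fin m)) ++
      gap (pre a k ++ gap (pre a k) (a k) ++ (a k : List (Fin m))) (List.replicate (x (k + 1)) 0) ++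
      List.replicate (x (k + 1)) 0 := fun _ _ => rfl
  have hpre : ∀ a k, pre a k ∈ language S.carrier ∧ (pre a k).length = n k + x k := by
    intro a k
    induction k with
    | zero => exact ⟨hrep _ (by have := hx 0; omega), by simp [pre, codedPrefix]⟩
    | succ k ih =>
      obtain ⟨g1, g2⟩ := hgap _ _ ih.1 (hlang k (a k))
      obtain ⟨g3, g4⟩ := hgap _ _ g2 (hrep _ (hx (k + 1)))
      refine ⟨hpres a k ▸ g4, ?_⟩
      have := length_of_mem_words (a k).2
      simp only [hpres, List.length_append, g3, ih.2, g1, this, List.length_replicate, hn]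
  have hprefix : ∀ a k, pre a k <+: pre a (k + 1) := fun a k =>
    ⟨_, by
      rw [hpres]
      simp only [List.append_assoc]
      rfl⟩
  have hmono : ∀ a, ∀ k k', k ≤ k' → pre a k <+: pre a k' := fun a k k' h => by
    induction k', h using Nat.le_induction with
    | base => exact List.prefix_refl _
    | succ k' _ ih => exact ih.trans (hprefix a k')
  have hlt : ∀ k, k < n k + x k := fun k => by
    induction k with
    | zero => have := hx 0; omega
    | succ k ih =>
      have := hx (k + 1)
      have := hl k
      have := hn k
      omega
  -- The prefix of index i is longer than i, so the default 0 is never used.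
  let Φ : (∀ k, words S.carrier (l k)) → ℕ → Fin m := fun a i => (pre a i).getD i 0
  have hΦ : ∀ a k, subword (Φ a) 0 (n k + x k) = pre a k := by
    intro a k
    refine List.ext_getElem (by simp [(hpre a k).2]) fun i h1 h2 => ?_
    have hi : i < (pre a i).length := by rw [(hpre a i).2]; exact hlt i
    simp only [subword, List.getElem_ofFn, zero_add, Φ]
    rw [List.getD_eq_getElem _ _ hi]
    rcases le_total i k with h | h
    · exact (hmono a i k h).getElem hi
    · exact ((hmono a k i h).getElem h2).symm
  refine ⟨Φ, ?_, fun a => ?_⟩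
  · let _ : MeasurableSpace (List (Fin m)) := ⊤
    have : DiscreteMeasurableSpace (List (Fin m)) := ⟨fun _ => trivial⟩
    have hmeas : ∀ k, Measurable fun a => pre a k := by
      intro k
      induction k with
      | zero => exact measurable_const
      | succ k ih =>
        let G : List (Fin m) × words S.carrier (l k) → List (Fin m) := fun p =>
          let q := p.1 ++ gap p.1 p.2 ++ p.2
          q ++ gap q (List.replicate (x (k + 1)) 0) ++ List.replicate (x (k + 1)) 0
        have hG : Measurable G := Measurable.of_discrete
        exact hG.comp (ih.prodMk (measurable_pi_apply k))
    refine measurable_pi_iff.2 fun i => ?_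
    have hg : Measurable fun w : List (Fin m) => w.getD i 0 := Measurable.of_discrete
    exact hg.comp (hmeas i)
  have hsplit : ∀ k, subword (Φ a) (n k + x k + M) (l k) = a k ∧
      subword (Φ a) (n (k + 1)) (x (k + 1)) = List.replicate (x (k + 1)) 0 := by
    intro k
    have h1 := hΦ a (k + 1)
    obtain ⟨g1, g2⟩ := hgap _ _ (hpre a k).1 (hlang k (a k))
    obtain ⟨g3, -⟩ := hgap _ _ g2 (hrep _ (hx (k + 1)))
    rw [subword_add, hpres] at h1
    obtain ⟨h3, h4⟩ := List.append_inj' h1 (by simp)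
    rw [zero_add] at h4
    rw [hn, subword_add] at h3
    obtain ⟨h5, -⟩ := List.append_inj' h3 (by rw [length_subword, g3])
    rw [subword_add] at h5
    obtain ⟨-, h6⟩ := List.append_inj' h5 (by simp [length_of_mem_words (a k).2])
    rw [zero_add] at h6
    exact ⟨h6, h4⟩
  have hrun : ∀ k, subword (Φ a) (n k) (x k) = List.replicate (x k) 0 := by
    intro k
    cases k with
    | zero =>
      have h1 := hΦ a 0
      have h2 : pre a 0 = List.replicate (n 0 + x 0) 0 := rfl
      rw [subword_add, h2, List.replicate_add] at h1
      simpa using (List.append_inj' h1 (by simp)).2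
    | succ k => exact (hsplit k).2
  refine ⟨?_, fun k => (hsplit k).1, fun k i hi => ?_⟩
  -- Each prefix extends to a point of the subshift; these points converge to `Φ a`, and the
  -- subshift is closed.
  · choose v hv hv' using fun k => exists_subword_eq_of_mem_language (hpre a k).1
    refine S.isClosed.mem_of_tendsto (f := v) (b := atTop) ?_ (Eventually.of_forall hv)
    refine tendsto_pi_nhds.2 fun i => tendsto_const_nhds.congr' ?_
    filter_upwards [eventually_ge_atTop i] with k hk
    have h1 := (hΦ a k).trans (hv' k)
    rw [(hpre a k).2] at h1
    simpa using eq_of_subword_eq h1 (hk.trans_lt (hlt k))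
  · have h1 : subword (Φ a) (n k) (x k) = subword (fun _ => 0) (n k) (x k) := by
      rw [hrun]; simp [subword]
    exact eq_of_subword_eq h1 hi

end Coding

/-! ### The coded measure and its cylinder masses -/

section CodedMeasure

variable {m : ℕ}

/-- Deleting the fixed prefix is injective, and shift invariance makes the remainder a word of the
subshift. -/
theorem ncard_words_with_prefix_le (S : SymbolicDynamics.FullShift.Subshift (Fin m) ℕ) {l c : ℕ}
    (hc : c ≤ l) (p : List (Fin m)) :
    {w : words S.carrier l | (w : List (Fin m)).take c = p}.ncard ≤
      (words S.carrier (l - c)).ncard := by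
  refine ncard_le_ncard_of_injOn (fun w => (w : List (Fin m)).drop c) ?_ ?_ (finite_words _ _)
  · rintro ⟨_, u, hu, rfl⟩ -
    have h : subword u 0 l = subword u 0 c ++ subword u c (l - c) := by
      have := subword_add u 0 c (l - c)
      rwa [Nat.add_sub_cancel' hc, zero_add] at this
    have h' : (List.ofFn fun i : Fin l => u i) = subword u 0 l := by simp [subword]
    simp only [h', h]
    rw [List.drop_left' (length_subword _ _ _)]
    exact subword_mem_words hu _ _
  · intro w hw w' hw' h
    simp only at h
    apply Subtype.ext
    rw [← List.take_append_drop c (w : List (Fin m)), ← List.take_append_drop c (w' : List (Fin m)),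
      h, hw.out, hw'.out]

theorem take_subword {α : Type*} (u : ℕ → α) (a : ℕ) {c l : ℕ} (hc : c ≤ l) :
    (subword u a l).take c = subword u a c := by
  rw [← Nat.add_sub_cancel' hc, subword_add, List.take_left' (length_subword _ _ _)]

theorem measurableSet_cylinder (w : ℕ → Fin m) (L : ℕ) :
    MeasurableSet {x : ℕ → Fin m | ∀ i < L, x i = w i} := by
  have : {x : ℕ → Fin m | ∀ i < L, x i = w i} = ⋂ i, ⋂ _ : i < L, {x | x i = w i} := by
    ext; simp
  rw [this]
  exact MeasurableSet.iInter fun i => MeasurableSet.iInter fun _ =>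
    measurableSet_eq_fun (measurable_pi_apply i) measurable_const

/-- A measure carried by the points of the subshift that vanish on prescribed blocks, giving
cylinders a mass that is exponentially small in the number of letters that are free. -/
theorem exists_coded_measure [NeZero m] (S : SymbolicDynamics.FullShift.Subshift (Fin m) ℕ) {M : ℕ}
    (hM : ∀ u ∈ language S.carrier, ∀ v ∈ language S.carrier,
      ∃ w ∈ words S.carrier M, u ++ w ++ v ∈ language S.carrier)
    (hzero : zeroSeq ∈ S.carrier) {n x l : ℕ → ℕ} (hx : ∀ k, 0 < x k) (hl : ∀ k, 0 < l k)
    (hn : ∀ k, n (k + 1) = n k + x k + M + l k + M) {δ : ℝ} (hδ : 0 < δ) :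
    ∃ C > 0, ∃ μ : Measure (ℕ → Fin m),
      μ {u ∈ S.carrier | ∀ k, ∀ i < x k, u (n k + i) = 0} ≠ 0 ∧
      ∀ k j L, j ≤ l k → n k + x k + M + j ≤ L → ∀ w : ℕ → Fin m,
        μ {u | ∀ i < L, u i = w i} ≤ ENNReal.ofReal (C * Real.exp (δ * l k -
          entropy S.carrier * (∑ i ∈ Finset.range k, (l i : ℝ) + j))) := by
  have hne : S.carrier.Nonempty := ⟨_, hzero⟩
  set h := entropy S.carrier with hh
  obtain ⟨C, hC, hN⟩ := exists_ncard_words_le (S := S) (show h < h + δ by linarith)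
  obtain ⟨Φ, hΦ, hΦa⟩ := exists_coding S hM hzero hx hl hn
  have : ∀ k, Nonempty (words S.carrier (l k)) := fun k =>
    let ⟨u, hu⟩ := hne
    ⟨⟨_, u, hu, rfl⟩⟩
  let ν : ∀ k, Measure (words S.carrier (l k)) := fun k => uniformOn univ
  let P := Measure.infinitePi ν
  refine ⟨C, hC, P.map Φ, fun h0 => ?_, fun k j L hj hL w => ?_⟩
  · have h1 := Measure.le_map_apply (μ := P) hΦ.aemeasurable
      {u ∈ S.carrier | ∀ k, ∀ i < x k, u (n k + i) = 0}
    have h2 : Φ ⁻¹' {u ∈ S.carrier | ∀ k, ∀ i < x k, u (n k + i) = 0} = univ :=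
      eq_univ_of_forall fun a => ⟨(hΦa a).1, (hΦa a).2.2⟩
    rw [h0, h2, measure_univ] at h1
    exact absurd h1 (by simp)
  rw [Measure.map_apply hΦ (measurableSet_cylinder w L)]
  have hmono : Monotone n := monotone_nat_of_le_succ fun i => by rw [hn]; omega
  -- A cylinder of length L determines the free words before k completely and at least the first j
  -- letters of the k-th one.
  let c : ℕ → ℕ := fun i => if i = k then j else l i
  have hcl : ∀ i, c i ≤ l i := fun i => by
    simp only [c]; split_ifs with hi
    · exact hi ▸ hj
    · exact le_rfl
  let t : ∀ i, Set (words S.carrier (l i)) := fun i =>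
    {b | (b : List (Fin m)).take (c i) = subword w (n i + x i + M) (c i)}
  have hsub : Φ ⁻¹' {u | ∀ i < L, u i = w i} ⊆ (↑(Finset.range (k + 1)) : Set ℕ).pi t := by
    intro a ha i hi
    have hi' : i ≤ k := Nat.lt_succ_iff.1 (Finset.mem_range.1 hi)
    have hiL : n i + x i + M + c i ≤ L := by
      simp only [c]
      split_ifs with h
      · rwa [h]
      · have h1 := hmono (show i + 1 ≤ k by omega)
        have h2 := hn i
        omega
    change List.take (c i) (a i : List (Fin m)) = _
    rw [← (hΦa a).2.1 i, take_subword _ _ (hcl i)]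
    exact congrArg List.ofFn (funext fun y => ha _ (by omega))
  have hν : ∀ i, ν i (t i) ≤ ENNReal.ofReal
      ((words S.carrier (l i - c i)).ncard * Real.exp (-(h * l i))) := by
    intro i
    let _ := Fintype.ofFinite (words S.carrier (l i))
    have h1 : Fintype.card (words S.carrier (l i)) = (words S.carrier (l i)).ncard := by
      rw [← Nat.card_eq_fintype_card, Nat.card_coe_set_eq]
    have h2 := exp_entropy_mul_le_ncard_words hne (l i)
    have h3 : ((t i).ncard : ℝ) ≤ (words S.carrier (l i - c i)).ncard := by
      exact_mod_cast ncard_words_with_prefix_le S (hcl i) _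
    change uniformOn univ (t i) ≤ _
    rw [uniformOn_univ, h1, Measure.count_apply .of_discrete, ← (toFinite (t i)).cast_ncard_eq]
    refine ENNReal.div_le_of_le_mul ?_
    rw [ENat.toENNReal_coe, ← ENNReal.ofReal_natCast, ← ENNReal.ofReal_natCast,
      ← ENNReal.ofReal_mul (by positivity)]
    refine ENNReal.ofReal_le_ofReal (h3.trans ?_)
    rw [mul_assoc]
    refine le_mul_of_one_le_right (Nat.cast_nonneg _) ?_
    rw [Real.exp_neg, inv_mul_eq_div, one_le_div (Real.exp_pos _)]
    exact h2
  refine (measure_mono hsub).trans ?_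
  rw [Measure.infinitePi_pi ν fun i _ => .of_discrete, Finset.prod_range_succ]
  have hprod : ∏ i ∈ Finset.range k, ν i (t i) ≤
      ENNReal.ofReal (Real.exp (-(h * ∑ i ∈ Finset.range k, (l i : ℝ)))) := by
    rw [Finset.mul_sum, ← Finset.sum_neg_distrib, Real.exp_sum,
      ENNReal.ofReal_prod_of_nonneg fun _ _ => (Real.exp_pos _).le]
    refine Finset.prod_le_prod' fun i hi => (hν i).trans (ENNReal.ofReal_le_ofReal ?_)
    have hik : c i = l i := if_neg (Finset.mem_range.1 hi).ne
    rw [hik, Nat.sub_self]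
    refine mul_le_of_le_one_left (Real.exp_pos _).le ?_
    have h0 : words S.carrier 0 ⊆ {[]} := by rintro _ ⟨u, -, rfl⟩; simp
    exact_mod_cast (ncard_le_ncard h0).trans (ncard_singleton _).le
  -- The partly seen word costs the factor e^(δ l_k): its completions are counted at rate h + δ,
  -- against at least e^(h l_k) words in total.
  have hlast : ν k (t k) ≤ ENNReal.ofReal
      (C * Real.exp ((h + δ) * (l k - j)) * Real.exp (-(h * l k))) := by
    refine (hν k).trans (ENNReal.ofReal_le_ofReal ?_)
    have hk : c k = j := if_pos rfl
    have h1 := hN (l k - j)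
    rw [Nat.cast_sub hj] at h1
    rw [hk]
    exact mul_le_mul_of_nonneg_right h1 (Real.exp_pos _).le
  refine (mul_le_mul' hprod hlast).trans ?_
  rw [← ENNReal.ofReal_mul (Real.exp_pos _).le, mul_comm, mul_assoc, mul_assoc, ← Real.exp_add,
    ← Real.exp_add]
  refine ENNReal.ofReal_le_ofReal (mul_le_mul_of_nonneg_left (Real.exp_le_exp.2 ?_) hC.le)
  have : 0 ≤ δ * (j : ℝ) := by positivity
  nlinarith

end CodedMeasure

/-- Makes errors linear in k negligible, since positions n_k grow at least like 2^k. -/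
theorem exists_mul_le_two_pow_add (A : ℝ) {δ : ℝ} (hδ : 0 < δ) :
    ∃ C : ℝ, ∀ k : ℕ, A * k ≤ δ * 2 ^ k + C := by
  have h1 : Tendsto (fun k : ℕ => A * ((k : ℝ) ^ 1 / 2 ^ k)) atTop (𝓝 (A * 0)) :=
    (tendsto_pow_const_div_const_pow_of_one_lt 1 (one_lt_two)).const_mul A
  rw [mul_zero] at h1
  obtain ⟨k₀, hk₀⟩ := eventually_atTop.1 (h1.eventually (eventually_le_nhds hδ))
  refine ⟨|A| * k₀, fun k => ?_⟩
  rcases le_total k₀ k with h | h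
  · have h2 := hk₀ k h
    rw [pow_one, mul_div_assoc', div_le_iff₀ (by positivity)] at h2
    have : 0 ≤ |A| * k₀ := by positivity
    linarith
  · have h2 : A * k ≤ |A| * k₀ :=
      mul_le_mul (le_abs_self A) (Nat.cast_le.2 h) (Nat.cast_nonneg _) (abs_nonneg _)
    have : 0 ≤ δ * 2 ^ k := by positivity
    linarith

/-- Points of `S` having, for every large `N`, a zero run of length at least `τ N` that starts in
`[1, N]`. -/
def uniformZeroRunsFrom {m : ℕ} [NeZero m] (S : Set (ℕ → Fin m)) (τ : ℝ) : Set (ℕ → Fin m) :=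
  {u ∈ S | ∀ᶠ N : ℕ in atTop, ∃ n, 1 ≤ n ∧ n ≤ N ∧ ∃ p : ℕ, τ * N ≤ p ∧ ∀ i < p, u (n + i) = 0}

/-! ### Block positions for the lower bound -/

section Positions

variable {n x : ℕ → ℕ} {M : ℕ} {v : ℝ}

theorem two_pow_le_of_recursion (h0 : n 0 = 1)
    (hn : ∀ k, n (k + 1) = n k + x k + M + n k + M) (k : ℕ) : 2 ^ k ≤ n k := by
  induction k with
  | zero => rw [h0, pow_zero]
  | succ k ih => rw [hn, pow_succ]; omega

/-- In the recursion `n (k + 1) = 2 n k + x k + 2 M`, `x k ≈ v n k`, the free letters make up at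
least a proportion `1 / (1 + v) ^ 2`, up to an error linear in `k`. -/
theorem div_sq_le_sum_of_recursion (hv : 0 < v) (h0 : n 0 = 1)
    (hx : ∀ k, (x k : ℝ) ≤ v * (n k + M) + 1)
    (hn : ∀ k, n (k + 1) = n k + x k + M + n k + M) (k : ℕ) :
    (n k + x k + M : ℝ) / (1 + v) ^ 2 ≤
      ∑ i ∈ Finset.range k, (n i : ℝ) + ((v + 2) * M + 1) * (k + 2 : ℕ) := by
  set A : ℝ := (v + 2) * M + 1 with hA
  have hA1 : 1 ≤ A := by
    have : 0 ≤ (v + 2) * (M : ℝ) := by positivity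
    linarith
  -- Telescoping: each increment n (k+1) - n k is at most (1 + v) n k + A.
  have hnk : ∀ k : ℕ, (n k : ℝ) ≤ (1 + v) * ∑ i ∈ Finset.range k, (n i : ℝ) + 1 + A * k := by
    intro k
    induction k with
    | zero => simp [h0]
    | succ k ih =>
      rw [Finset.sum_range_succ, hn]
      have := hx k
      push_cast
      nlinarith
  have h1 := hnk k
  have h2 := hx k
  have hM0 : (0 : ℝ) ≤ M := Nat.cast_nonneg _
  have hk0 : (0 : ℝ) ≤ k := Nat.cast_nonneg _
  rw [div_le_iff₀ (by positivity)]
  set F := ∑ i ∈ Finset.range k, (n i : ℝ)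
  have h3 : (n k + x k + M : ℝ) ≤ (1 + v) * n k + A := by nlinarith
  have h4 : (1 + v) * n k ≤ (1 + v) * ((1 + v) * F + 1 + A * k) :=
    mul_le_mul_of_nonneg_left h1 (by positivity)
  have h5 : (1 + v) * (1 + A * k) + A ≤ A * (k + 2 : ℕ) * (1 + v) ^ 2 := by
    have h6 : 1 + A * k + A ≤ A * (k + 2 : ℕ) := by push_cast; nlinarith
    have h7 : (1 + v) * (1 + A * k) + A ≤ (1 + v) * (1 + A * k + A) := by nlinarith
    have h8 : (1 + v) * (1 + A * k + A) ≤ (1 + v) * (A * (k + 2 : ℕ)) :=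
      mul_le_mul_of_nonneg_left h6 (by positivity)
    have h9 : (1 + v) * (A * (k + 2 : ℕ)) ≤ (1 + v) ^ 2 * (A * (k + 2 : ℕ)) := by
      refine mul_le_mul_of_nonneg_right ?_ (by positivity)
      nlinarith
    linarith
  nlinarith

end Positions

theorem le_dimH_uniformZeroRunsFrom {m : ℕ} [m.AtLeastTwo]
    (S : SymbolicDynamics.FullShift.Subshift (Fin m) ℕ) (hspec : HasSpecification S.carrier)
    (hent : 0 < entropy S.carrier) (hzero : zeroSeq ∈ S.carrier) {τ : ℝ} (hτ0 : 0 < τ)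
    (hτ1 : τ < 1) :
    ENNReal.ofReal (((1 - τ) / (1 + τ)) ^ 2 * entropy S.carrier / Real.log m) ≤
      dimH (uniformZeroRunsFrom S.carrier τ) := by
  obtain ⟨M, hM⟩ := hspec
  have hlog := log_card_pos (m := m)
  set h := entropy S.carrier with hh
  have hτ1' : 0 < 1 - τ := by linarith
  -- Solves v = τ (2 + v), that is x_k ≈ τ n_{k+1} when n_{k+1} ≈ (2 + v) n_k. Free words of length
  -- λ n_k would leave the proportion (1-τ)² / (1 + τ² + τ(λ + 1/λ)), which is largest at λ = 1.
  set v : ℝ := 2 * τ / (1 - τ) with hv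
  have hv0 : 0 < v := by positivity
  have hβ : ((1 - τ) / (1 + τ)) ^ 2 = 1 / (1 + v) ^ 2 := by
    rw [hv]
    field_simp
    ring
  rw [hβ]
  set β := 1 / (1 + v) ^ 2 with hβd
  have hβ0 : 0 < β := by positivity
  have hβ1 : β ≤ 1 := by
    rw [hβd, div_le_one (by positivity)]
    nlinarith
  let X : ℕ → ℕ := fun a => ⌈v * ((a : ℝ) + M)⌉₊
  let n : ℕ → ℕ := fun k => Nat.rec (motive := fun _ => ℕ) 1 (fun _ a => a + X a + M + a + M) k
  let x : ℕ → ℕ := fun k => X (n k)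
  have hn : ∀ k, n (k + 1) = n k + x k + M + n k + M := fun _ => rfl
  have h2n : ∀ k, 2 ^ k ≤ n k := two_pow_le_of_recursion (show n 0 = 1 from rfl) hn
  have hnpos : ∀ k, 0 < n k := fun k => (Nat.two_pow_pos k).trans_le (h2n k)
  have hxle : ∀ k, (x k : ℝ) ≤ v * (n k + M) + 1 := fun k =>
    (Nat.ceil_lt_add_one (by positivity)).le
  have hxge : ∀ k, v * (n k + M) ≤ (x k : ℝ) := fun k => Nat.le_ceil _
  have hxpos : ∀ k, 0 < x k := fun k => by
    have : (0 : ℝ) < n k := by exact_mod_cast hnpos k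
    change 0 < ⌈v * ((n k : ℝ) + M)⌉₊
    exact Nat.ceil_pos.2 (by positivity)
  have hfree := div_sq_le_sum_of_recursion hv0 rfl hxle hn
  have hhit : {u ∈ S.carrier | ∀ k, ∀ i < x k, u (n k + i) = 0} ⊆
      uniformZeroRunsFrom S.carrier τ := by
    rintro u ⟨huS, hu⟩
    refine ⟨huS, ?_⟩
    filter_upwards [eventually_ge_atTop 1] with N hN
    have hex : ∃ k, N < n k := ⟨N, Nat.lt_two_pow_self.trans_le (h2n N)⟩
    classical
    obtain ⟨k, hk⟩ := Nat.exists_eq_succ_of_ne_zero (show Nat.find hex ≠ 0 from fun h0 => by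
      have h1 := Nat.find_spec hex
      rw [h0] at h1
      exact absurd h1 (not_lt.2 hN))
    have h1 := Nat.find_spec hex
    have h2 := Nat.find_min hex (show k < Nat.find hex by omega)
    rw [hk, Nat.succ_eq_add_one, hn] at h1
    refine ⟨n k, hnpos k, not_lt.1 h2, x k, ?_, hu k⟩
    have h3 : (N : ℝ) ≤ n k + x k + M + n k + M := by exact_mod_cast h1.le
    have h4 := hxge k
    rw [hv, div_mul_eq_mul_div, div_le_iff₀ hτ1'] at h4
    nlinarith
  have key : ∀ c, 0 < c → c < h * β →
      ENNReal.ofReal (c / Real.log m) ≤ dimH (uniformZeroRunsFrom S.carrier τ) := by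
    intro c hc hcβ
    -- Of the spare 4δL, one δL pays for the partly seen free word, one for the error linear in k,
    -- and two for the constants once L ≥ L₁.
    set δ := (h * β - c) / 4 with hδ
    have hδ0 : 0 < δ := by rw [hδ]; linarith
    obtain ⟨C, hC, μ, hμ, hcyl⟩ := exists_coded_measure S hM hzero hxpos hnpos hn hδ0
    set A : ℝ := (v + 2) * M + 1
    have hA0 : 0 < A := by positivity
    obtain ⟨B, hB⟩ := exists_mul_le_two_pow_add (h * A) hδ0
    obtain ⟨L₁, hL₁⟩ := exists_nat_gt ((Real.log C + B + 3 * (h * A) + c) / (2 * δ))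
    rw [div_lt_iff₀ (by positivity)] at hL₁
    refine (le_dimH_of_measure_cylinder_le μ hμ hc (max L₁ (n 0 + x 0 + M))
      fun L hL w => ?_).trans (dimH_mono hhit)
    have hLL₁ : (L₁ : ℝ) ≤ L := Nat.cast_le.2 ((le_max_left _ _).trans hL)
    obtain ⟨k, hk1, hk2⟩ : ∃ k, n k + x k + M ≤ L ∧ L < n (k + 1) + x (k + 1) + M := by
      have hex : ∃ k, L < n k + x k + M :=
        ⟨L, by have := (Nat.lt_two_pow_self (n := L)).trans_le (h2n L); omega⟩
      classical
      obtain ⟨k, hk⟩ := Nat.exists_eq_succ_of_ne_zero (show Nat.find hex ≠ 0 from fun h0 => by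
        have h1 := Nat.find_spec hex
        rw [h0] at h1
        exact absurd h1 (not_lt.2 ((le_max_right _ _).trans hL)))
      refine ⟨k, not_lt.1 (Nat.find_min hex (show k < Nat.find hex by omega)), ?_⟩
      have h1 := Nat.find_spec hex
      rwa [hk] at h1
    -- Either L ends within the k-th free word, where every letter counts and β ≤ 1, or that word is
    -- complete and the estimate at the end of the next zero block applies.
    obtain ⟨j, hj1, hj2, hj3⟩ : ∃ j, j ≤ n k ∧ n k + x k + M + j ≤ L ∧
        β * L ≤ ∑ i ∈ Finset.range k, (n i : ℝ) + j + A * (k + 3 : ℕ) := by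
      rcases le_total (L - (n k + x k + M)) (n k) with h1 | h1
      · refine ⟨L - (n k + x k + M), h1, by omega, ?_⟩
        have h2 := hfree k
        have h3 : (L : ℝ) = (n k + x k + M) + (L - (n k + x k + M) : ℕ) := by
          rw [Nat.cast_sub hk1]; push_cast; ring
        have h4 : 0 ≤ ((L - (n k + x k + M) : ℕ) : ℝ) := Nat.cast_nonneg _
        rw [div_eq_mul_one_div, ← hβd] at h2
        rw [h3, mul_add]
        push_cast at h2 h4 ⊢
        nlinarith
      · refine ⟨n k, le_rfl, by omega, ?_⟩
        have h2 := hfree (k + 1)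
        have h3 : (L : ℝ) ≤ n (k + 1) + x (k + 1) + M := by exact_mod_cast hk2.le
        rw [div_eq_mul_one_div, ← hβd, Finset.sum_range_succ] at h2
        have h4 := mul_le_mul_of_nonneg_left h3 hβ0.le
        rw [show k + 3 = k + 1 + 2 by ring]
        linarith
    refine (hcyl k j L hj1 hj2 w).trans (ENNReal.ofReal_le_ofReal ?_)
    rw [← Real.exp_log hC, ← Real.exp_add]
    refine Real.exp_le_exp.2 ?_
    have hkL : (2 : ℝ) ^ k ≤ L := by
      have := h2n k
      exact_mod_cast (show 2 ^ k ≤ L by omega)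
    have hnL : (n k : ℝ) ≤ L := Nat.cast_le.2 (by omega)
    have h1 := hB k
    have h2 := mul_le_mul_of_nonneg_left hj3 hent.le
    have h3 := mul_le_mul_of_nonneg_left hkL hδ0.le
    have h4 := mul_le_mul_of_nonneg_left hnL hδ0.le
    have h5 := mul_le_mul_of_nonneg_right hLL₁ (show 0 ≤ 2 * δ by positivity)
    have h6 : h * β = c + 4 * δ := by rw [hδ]; ring
    have h7 : h * (β * L) = c * L + 4 * (δ * L) := by rw [← mul_assoc, h6]; ring
    rw [h7] at h2
    push_cast at h2 ⊢
    nlinarith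
  have hlim : Tendsto (fun c : ℝ => ENNReal.ofReal (c / Real.log m)) (𝓝[<] (β * h))
      (𝓝 (ENNReal.ofReal (β * h / Real.log m))) :=
    ENNReal.tendsto_ofReal ((tendsto_id.div_const _).mono_left nhdsWithin_le_nhds)
  refine le_of_tendsto hlim ?_
  filter_upwards [Ioo_mem_nhdsLT (show 0 < β * h by positivity)] with c hc
  exact key c hc.1 (by rw [mul_comm]; exact hc.2)

/-! ### From shrinking targets to zero runs -/

section HitTimes

variable {m : ℕ}

theorem leftShift_iterate_apply (u : ℕ → Fin m) (n i : ℕ) : leftShift^[n] u i = u (n + i) := by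
  induction n generalizing i with
  | zero => simp
  | succ n ih =>
    rw [Function.iterate_succ_apply']
    change leftShift^[n] u (i + 1) = _
    rw [ih]
    congr 1
    ring

theorem leftShift_iterate_mem {S : SymbolicDynamics.FullShift.Subshift (Fin m) ℕ} {u : ℕ → Fin m}
    (hu : u ∈ S.carrier) (n : ℕ) : leftShift^[n] u ∈ S.carrier := by
  have : leftShift^[n] u = SymbolicDynamics.FullShift.shift n u :=
    funext fun i => leftShift_iterate_apply u n i
  rw [this]
  exact S.mapsTo n hu

variable [m.AtLeastTwo]

theorem dist_leftShift_iterate_lt_iff (u : ℕ → Fin m) (n p : ℕ) :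
    dist (leftShift^[n] u) zeroSeq < Real.exp (-(Real.log m * p)) ↔ ∀ i < p, u (n + i) = 0 := by
  rw [← inv_card_pow_eq_exp]
  refine (wordDist_lt_iff _ _ p).trans ?_
  simp [leftShift_iterate_apply, zeroSeq]

theorem le_exp_of_lt_logb_div {c r : ℝ} {N : ℕ} (hN : 0 < N) (hr : 0 < r)
    (h : c < -Real.logb m r / N) : r ≤ Real.exp (-(Real.log m * (c * N))) := by
  have hlog := log_card_pos (m := m)
  rw [lt_div_iff₀ (by exact_mod_cast hN), Real.logb, ← neg_div, lt_div_iff₀ hlog] at h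
  rw [← Real.log_le_iff_le_exp hr]
  nlinarith

theorem exp_le_of_logb_div_lt {c r : ℝ} {N : ℕ} (hN : 0 < N) (hr : 0 < r)
    (h : -Real.logb m r / N < c) : Real.exp (-(Real.log m * (c * N))) ≤ r := by
  have hlog := log_card_pos (m := m)
  rw [div_lt_iff₀ (by exact_mod_cast hN), Real.logb, ← neg_div, div_lt_iff₀ hlog] at h
  rw [← Real.le_log_iff_exp_le hr]
  nlinarith

variable {S : SymbolicDynamics.FullShift.Subshift (Fin m) ℕ} {ψ : ℝ → ℝ} {τ : EReal}

theorem eventually_zero_run_of_mem_Hea (hψ : ∀ x, 0 < x → 0 < ψ x)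
    (hτ : Tendsto (fun N : ℕ => ((-Real.logb m (ψ N) / N : ℝ) : EReal)) atTop (𝓝 τ))
    {c : ℝ} (hc0 : 0 < c) (hc : (c : EReal) < τ)
    {u : ℕ → Fin m} (hu : u ∈ Hea S.carrier ψ) :
    ∀ᶠ N : ℕ in atTop, ∃ n, 1 ≤ n ∧ n ≤ N ∧ ∀ i < ⌊c * N⌋₊, u (n + i) = 0 := by
  filter_upwards [hu.2, hτ.eventually (lt_mem_nhds hc), eventually_gt_atTop 0]
    with N ⟨n, hn1, hnN, _, hd⟩ h1 hN
  refine ⟨n, hn1, hnN, (dist_leftShift_iterate_lt_iff u n _).1 (hd.trans_le ?_)⟩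
  have hN' : (0 : ℝ) < N := by exact_mod_cast hN
  refine (le_exp_of_lt_logb_div hN (hψ _ hN') (EReal.coe_lt_coe_iff.1 h1)).trans ?_
  refine Real.exp_le_exp.2 (neg_le_neg (mul_le_mul_of_nonneg_left ?_ log_card_pos.le))
  exact Nat.floor_le (by positivity)

theorem Hea_subset_uniformZeroRuns (hψ : ∀ x, 0 < x → 0 < ψ x)
    (hτ : Tendsto (fun N : ℕ => ((-Real.logb m (ψ N) / N : ℝ) : EReal)) atTop (𝓝 τ))
    {c : ℝ} (hc0 : 0 < c) (hc : (c : EReal) < τ) :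
    Hea S.carrier ψ ⊆ uniformZeroRuns S.carrier c := by
  intro u hu
  -- The margin c' - c absorbs the floor and the passage from N to N + 1.
  obtain ⟨c', hc1, hc2⟩ := EReal.lt_iff_exists_real_btwn.1 hc
  rw [EReal.coe_lt_coe_iff] at hc1
  refine ⟨hu.1, ?_⟩
  filter_upwards [eventually_zero_run_of_mem_Hea hψ hτ (hc0.trans hc1) hc2 hu,
    tendsto_natCast_atTop_atTop.eventually (eventually_ge_atTop ((1 + c) / (c' - c)))]
    with N ⟨n, _, hnN, hz⟩ hN
  refine ⟨n, hnN, _, ?_, hz⟩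
  rw [div_le_iff₀ (sub_pos.2 hc1)] at hN
  have := Nat.lt_floor_add_one (c' * N)
  nlinarith

theorem uniformZeroRunsFrom_subset_Hea (hψ : ∀ x, 0 < x → 0 < ψ x)
    (hτ : Tendsto (fun N : ℕ => ((-Real.logb m (ψ N) / N : ℝ) : EReal)) atTop (𝓝 τ))
    {c : ℝ} (hc : τ < c) :
    uniformZeroRunsFrom S.carrier c ⊆ Hea S.carrier ψ := by
  rintro u ⟨huS, hu⟩
  refine ⟨huS, ?_⟩
  filter_upwards [hu, hτ.eventually (gt_mem_nhds hc), eventually_gt_atTop 0]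
    with N ⟨n, hn1, hnN, p, hp, hz⟩ h1 hN
  have hN' : (0 : ℝ) < N := by exact_mod_cast hN
  refine ⟨n, hn1, hnN, leftShift_iterate_mem huS n,
    ((dist_leftShift_iterate_lt_iff u n p).2 hz).trans_le ?_⟩
  refine le_trans ?_ (exp_le_of_logb_div_lt hN (hψ _ hN') (EReal.coe_lt_coe_iff.1 h1))
  exact Real.exp_le_exp.2 (neg_le_neg (mul_le_mul_of_nonneg_left hp log_card_pos.le))

theorem Hea_eq_iUnion_of_one_lt (hψ : ∀ x, 0 < x → 0 < ψ x)
    (hτ : Tendsto (fun N : ℕ => ((-Real.logb m (ψ N) / N : ℝ) : EReal)) atTop (𝓝 τ))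
    (h1 : 1 < τ) :
    Hea S.carrier ψ = ⋃ n : ℕ, {u ∈ S.carrier | leftShift^[n] u = zeroSeq} := by
  ext u
  rw [mem_iUnion]
  constructor
  · intro hu
    obtain ⟨c, hc1, hc2⟩ := EReal.lt_iff_exists_real_btwn.1 h1
    have hc1' : 1 < c := by exact_mod_cast hc1
    obtain ⟨N₀, hN₀⟩ := eventually_atTop.1
      ((eventually_zero_run_of_mem_Hea hψ hτ (zero_lt_one.trans hc1') hc2 hu).and
        (tendsto_natCast_atTop_atTop.eventually (eventually_ge_atTop (1 / (c - 1)))))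
    refine ⟨N₀ + 1, hu.1, funext fun i => ?_⟩
    rw [leftShift_iterate_apply]
    obtain ⟨⟨n, hn1, hnN, hz⟩, hN⟩ := hN₀ (N₀ + i) (Nat.le_add_right _ _)
    rw [div_le_iff₀ (sub_pos.2 hc1')] at hN
    -- With N = N₀ + i, a run of length at least N + 1 starting at n ≤ N covers position N + 1.
    have h2 : N₀ + i + 1 ≤ ⌊c * (N₀ + i : ℕ)⌋₊ := Nat.le_floor (by push_cast at hN ⊢; linarith)
    have h3 := hz (N₀ + i + 1 - n) (by omega)
    rw [show n + (N₀ + i + 1 - n) = N₀ + 1 + i by omega] at h3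
    exact h3
  · rintro ⟨n, huS, hu⟩
    have hz : ∀ i, u (n + i) = 0 := fun i => by
      rw [← leftShift_iterate_apply u n i, hu]; rfl
    refine ⟨huS, ?_⟩
    filter_upwards [eventually_ge_atTop (n + 1)] with N hN
    -- The time n + 1 is used because hitting times must be at least 1, while n may be 0.
    refine ⟨n + 1, by omega, hN, leftShift_iterate_mem huS _, ?_⟩
    have h2 : leftShift^[n + 1] u = zeroSeq := funext fun i => by
      rw [leftShift_iterate_apply, show n + 1 + i = n + (1 + i) by ring, hz]; rfl
    rw [h2, dist_self]
    exact hψ _ (by exact_mod_cast (Nat.succ_pos n).trans_le hN)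

end HitTimes

/-! ### Passage to the limit and the dimension formula -/

theorem tendsto_ofReal_dimension_bound (a : ℝ) {t : ℝ} (ht : 0 ≤ t) :
    Tendsto (fun s : ℝ => ENNReal.ofReal (((1 - s) / (1 + s)) ^ 2 * a)) (𝓝 t)
      (𝓝 (ENNReal.ofReal (((1 - t) / (1 + t)) ^ 2 * a))) := by
  refine ENNReal.tendsto_ofReal (ContinuousAt.tendsto ?_)
  have : 1 + t ≠ 0 := by positivity
  fun_prop (disch := assumption)

/-- The lower bound comes from the subsets `uniformZeroRunsFrom S.carrier s` as s decreases to 0. -/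
theorem dimH_subshift {m : ℕ} [m.AtLeastTwo]
    (S : SymbolicDynamics.FullShift.Subshift (Fin m) ℕ) (hspec : HasSpecification S.carrier)
    (hent : 0 < entropy S.carrier) (hzero : zeroSeq ∈ S.carrier) :
    dimH S.carrier = ENNReal.ofReal (entropy S.carrier / Real.log m) := by
  refine le_antisymm (dimH_subshift_le S) ?_
  have h := (tendsto_ofReal_dimension_bound (entropy S.carrier / Real.log m) le_rfl).mono_left
    (nhdsWithin_le_nhds (s := Ioi 0))
  simp only [sub_zero, add_zero, div_one, one_pow, one_mul] at h
  refine le_of_tendsto h ?_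
  filter_upwards [Ioo_mem_nhdsGT (zero_lt_one (α := ℝ))] with s hs
  rw [← mul_div_assoc]
  exact (le_dimH_uniformZeroRunsFrom S hspec hent hzero hs.1 hs.2).trans
    (dimH_mono fun u hu => hu.1)

theorem dimH_Hea {m : ℕ} [m.AtLeastTwo]
    (S : SymbolicDynamics.FullShift.Subshift (Fin m) ℕ) (hspec : HasSpecification S.carrier)
    (hent : 0 < entropy S.carrier) (hzero : zeroSeq ∈ S.carrier) {ψ : ℝ → ℝ}
    (hψ : ∀ x, 0 < x → 0 < ψ x) {t : ℝ} (ht0 : 0 ≤ t) (ht1 : t ≤ 1)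
    (hτ : Tendsto (fun N : ℕ => ((-Real.logb m (ψ N) / N : ℝ) : EReal)) atTop (𝓝 (t : EReal))) :
    dimH (Hea S.carrier ψ) =
      ENNReal.ofReal (((1 - t) / (1 + t)) ^ 2) * dimH S.carrier := by
  have hlim := tendsto_ofReal_dimension_bound (entropy S.carrier / Real.log m) ht0
  rw [dimH_subshift S hspec hent hzero, ← ENNReal.ofReal_mul (sq_nonneg _)]
  refine le_antisymm ?_ ?_
  -- Values s < t give the upper bound and values s > t the lower one. The endpoints t = 0 and t =
  -- 1, where no such s lies in (0, 1), are trivial for the respective bound.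
  · rcases ht0.eq_or_lt with rfl | ht
    · simpa using (dimH_mono fun u hu => hu.1).trans (dimH_subshift_le S)
    · refine ge_of_tendsto (hlim.mono_left (nhdsWithin_le_nhds (s := Iio t))) ?_
      filter_upwards [Ioo_mem_nhdsLT ht] with s hs
      rw [← mul_div_assoc]
      exact (dimH_mono (Hea_subset_uniformZeroRuns hψ hτ hs.1 (EReal.coe_lt_coe_iff.2 hs.2))).trans
        (dimH_uniformZeroRuns_le S hs.1 (hs.2.trans_le ht1))
  · rcases ht1.eq_or_lt with rfl | ht
    · simp
    · refine le_of_tendsto (hlim.mono_left (nhdsWithin_le_nhds (s := Ioi t))) ?_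
      filter_upwards [Ioo_mem_nhdsGT ht] with s hs
      rw [← mul_div_assoc]
      exact (le_dimH_uniformZeroRunsFrom S hspec hent hzero (ht0.trans_lt hs.1) hs.2).trans
        (dimH_mono (uniformZeroRunsFrom_subset_Hea hψ hτ (EReal.coe_lt_coe_iff.2 hs.1)))

end SymbolicShift

theorem theorem1p2 {m : ℕ} [m.AtLeastTwo]
    (S : SymbolicDynamics.FullShift.Subshift (Fin m) ℕ)
    (hspec : SymbolicShift.HasSpecification S.carrier)
    (hent : 0 < SymbolicShift.entropy S.carrier)
    (hzero : SymbolicShift.zeroSeq ∈ S.carrier)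
    (ψ : ℝ → ℝ) (hψpos : ∀ x, 0 < x → 0 < ψ x) (hψlim : Tendsto ψ atTop (𝓝 0))
    (τ : EReal)
    (hτ : Tendsto (fun N : ℕ => ((-Real.logb m (ψ N) / N : ℝ) : EReal)) atTop (𝓝 τ)) :
    (1 < τ →
      SymbolicShift.Hea S.carrier ψ =
        ⋃ n : ℕ, {u ∈ S.carrier | SymbolicShift.leftShift^[n] u = SymbolicShift.zeroSeq}) ∧
    (0 ≤ τ → τ ≤ 1 →
      dimH (SymbolicShift.Hea S.carrier ψ) =
        ENNReal.ofReal (((1 - τ.toReal) / (1 + τ.toReal)) ^ 2) * dimH S.carrier) := by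
  refine ⟨SymbolicShift.Hea_eq_iUnion_of_one_lt hψpos hτ, fun h0 h1 => ?_⟩
  lift τ to ℝ using ⟨(h1.trans_lt (EReal.coe_lt_top 1)).ne, ((EReal.bot_lt_coe 0).trans_le h0).ne'⟩
  exact SymbolicShift.dimH_Hea S hspec hent hzero hψpos (by exact_mod_cast h0)
    (by exact_mod_cast h1) hτ
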